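/- **Setting.** Let $Y\subseteq\mathbb R^{m}$ be closed and convex, $f:\mathbb R^{n}\times Y\to\mathbb R$ differentiable in each variable, $P(x)=\max_{y\in Y}f(x,y)$, and for $\phi:\mathbb R^n\times Y\to\mathbb R$ let $\mathrm{Gap}_\phi(x,y)=\max_{y'\in Y}\phi(x,y')-\min_{x'\in\mathbb R^n}\phi(x',y)$. Let $\mu,\mu_y,\sigma,\varepsilon_0>0$ and assume: * the gradient field $(\nabla_xf,-\nabla_yf)$ is $\ell$-Lipschitz on $\mathbb R^n\times Y$; $f(x,\cdot)$ is $\mu_y$-strongly concave on $Y$ for every $x$; $P$ has an $L$-Lipschitz gradient for some $L$, and a minimizer $x_*$; the starting point $(x_0,y_0)\in\mathbb R^n\times Y$ satisfies $\mathrm{Gap}_f(x_0,y_0)\le\varepsilon_0$; * $\|\nabla P(x)\|^2\ge 2\mu\,(P(x)-P(x_*))$ for all $x$; * $f(\cdot,y)$ is $\rho$-weakly convex for every $y\in Y$, where $0<\rho\le\ell$ and $\rho\le\mu/8$; * unbiased stochastic gradients $\nabla_xf(x,y;\xi)$, $\nabla_yf(x,y;\xi)$ are available, with $\mathbb E\|\nabla_xf(x,y;\xi)-\nabla_xf(x,y)\|^2\le\sigma^2$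 and $\mathbb E\|\nabla_yf(x,y;\xi)-\nabla_yf(x,y)\|^2\le\sigma^2$ for all $(x,y)\in\mathbb R^n\times Y$. **Algorithm.** Let $\gamma=\mu/4$ and $\Pi_{\bar z}(g)=\arg\min_{z\in\mathbb R^n\times Y}\{g^\top z+\frac12\|z-\bar z\|^2\}$. For $k=1,2,\dots$ put $(x_0^k,y_0^k)=(x_{k-1},y_{k-1})$ and $f_k(x,y)=f(x,y)+\frac\gamma2\|x-x_0^k\|^2$. Let $\mathcal G_k(z;\xi)=(\nabla_xf(x,y;\xi)+\gamma(x-x_0^k),\,-\nabla_yf(x,y;\xi))$ for $z=(x,y)$. Starting from $z_0=\tilde z_0=(x_0^k,y_0^k)$, perform for $t=1,\dots,T_k$ the OGDA steps $$z_t=\Pi_{\tilde z_{t-1}}(\eta_k\mathcal G_k(z_{t-1};\xi^k_{t-1})),\qquad \tilde z_t=\Pi_{\tilde z_{t-1}}(\eta_k\mathcal G_k(z_t;\xi^k_t)),$$ all samples $\xi^k_t$ being independent, and set $(x_k,y_k)=\frac1{T_k}\sum_{t=1}^{T_k}z_t$. Let $M=\max\{\ell,\mu\}$ (so $M=\ell$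 if $\mu\le\ell$), and take $$\eta_k=\eta_0e^{-(k-1)/16},\qquad T_k=\Big\lceil\frac{384}{\eta_0\min\{\mu/8,\mu_y\}}\,e^{(k-1)/16}\Big\rceil,\qquad \Delta_k=475\,(P(x_0^k)-P(x_*))+57\,\mathrm{Gap}_{f_k}(x_0^k,y_0^k).$$ **Theorem.** (a) For every $0<\eta_0\le\frac1{2\sqrt2M}$, each $\Delta_k$ ($k\ge1$) is integrable and $$\mathbb E[\Delta_{k+1}]\le e^{-1/16}\,\mathbb E[\Delta_k]+7800\,\eta_k\sigma^2 .$$ Moreover, for every $\varepsilon>0$, $\mathbb E[\Delta_{K+1}]\le\varepsilon$ for every integer $K\ge0$ such that $$K\ge\max\Big\{16\log\frac{1200\,\varepsilon_0}{\varepsilon},\;16\log\frac{15600\,\eta_0K\sigma^2}{\varepsilon}\Big\}$$ (where for $K=0$ the second term is dropped). (b) For $\eta_0=\frac1{2\sqrt2M}$ and every $\varepsilon>0$ there is a smallest such $K$, and with a universal constant $C$ it satisfies $$K\le C\log\Big(2+\frac{\varepsilon_0}\varepsilon+\frac{\sigma^2}{M\varepsilon}\Big),\qquad \sum_{k=1}^KT_k\le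 C\log\Big(2+\frac{\varepsilon_0}\varepsilon+\frac{\sigma^2}{M\varepsilon}\Big)\cdot\frac{\max\{M\varepsilon_0,\sigma^2\}}{\min\{\mu,\mu_y\}\,\varepsilon}.$$ Thus the total iteration complexity is $\widetilde O\Big(\frac{\max\{M\varepsilon_0,\sigma^2\}}{\min\{\mu,\mu_y\}\varepsilon}\Big)$, that is, $\widetilde O\Big(\frac{\max\{\ell\varepsilon_0,\sigma^2\}}{\min\{\mu,\mu_y\}\varepsilon}\Big)$ when $\mu\le\ell$. -/

import Mathlib

open MeasureTheory ProbabilityTheory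
open scoped Gradient RealInnerProductSpace

noncomputable section

namespace PES

/-- `ℝⁿ` with the Euclidean norm. -/
abbrev Vec (n : ℕ) : Type := EuclideanSpace ℝ (Fin n)

/-! ### Function classes -/

/-- `h` is `L`-smooth on `ℝⁿ`: differentiable, with an `L`-Lipschitz gradient. -/
def LSmooth {n : ℕ} (h : Vec n → ℝ) (L : ℝ) : Prop :=
  Differentiable ℝ h ∧ ∀ x x' : Vec n, ‖∇ h x - ∇ h x'‖ ≤ L * ‖x - x'‖

/-- The Polyak-Lojasiewicz inequality with constant `μ`, relative to the global minima of `h`. -/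
def PLCondition {n : ℕ} (h : Vec n → ℝ) (μ : ℝ) : Prop :=
  ∀ xs : Vec n, (∀ x, h xs ≤ h x) → ∀ x, 2 * μ * (h x - h xs) ≤ ‖∇ h x‖ ^ 2

/-- The primal objective `P(x) = max_{y ∈ Y} f(x, y)`. -/
def primal {n m : ℕ} (Y : Set (Vec m)) (f : Vec n → Vec m → ℝ) (x : Vec n) : ℝ :=
  sSup ((fun y => f x y) '' Y)

/-- The duality gap `max_{y' ∈ Y} f(x, y') - min_{x'} f(x', y)` of the pair `z = (x, y)`. -/
def gap {n m : ℕ} (Y : Set (Vec m)) (f : Vec n → Vec m → ℝ) (z : Vec n × Vec m) : ℝ :=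
  primal Y f z.1 - sInf (Set.range fun x' => f x' z.2)

/-- The proximally regularized objective `f(x, y) + (γ / 2) ‖x - c‖²`. -/
def regularized {n m : ℕ} (f : Vec n → Vec m → ℝ) (γ : ℝ) (c : Vec n) :
    Vec n → Vec m → ℝ :=
  fun x y => f x y + γ / 2 * ‖x - c‖ ^ 2

/-- The standing assumptions on the objective `f` on `ℝⁿ × Y`.  The functions `gx`, `gy` are the
partial gradients; only differentiability relative to `Y` is asked for in `y`. -/
structure IsSmoothNCSC {n m : ℕ} (Y : Set (Vec m)) (f : Vec n → Vec m → ℝ)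
    (gx : Vec n → Vec m → Vec n) (gy : Vec n → Vec m → Vec m) (ℓ μy L : ℝ) : Prop where
  isClosed : IsClosed Y
  convex : Convex ℝ Y
  hasGradientX : ∀ x, ∀ y ∈ Y, HasGradientAt (fun x' => f x' y) (gx x y) x
  hasGradientY : ∀ x, ∀ y ∈ Y, HasGradientWithinAt (fun y' => f x y') (gy x y) Y y
  /-- The gradient field is `ℓ`-Lipschitz on `ℝⁿ × Y` for the Euclidean norm of pairs. -/
  lipschitz : ∀ x x', ∀ y ∈ Y, ∀ y' ∈ Y,
    ‖gx x y - gx x' y'‖ ^ 2 + ‖gy x y - gy x' y'‖ ^ 2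
      ≤ ℓ ^ 2 * (‖x - x'‖ ^ 2 + ‖y - y'‖ ^ 2)
  strongConcave : ∀ x, StrongConcaveOn Y μy (fun y => f x y)
  primal_smooth : LSmooth (primal Y f) L
  exists_min : ∃ xs, ∀ x, primal Y f xs ≤ primal Y f x

/-- `f(·, y)` is `ρ`-weakly convex for every `y ∈ Y`. -/
def WeaklyConvexX {n m : ℕ} (Y : Set (Vec m)) (f : Vec n → Vec m → ℝ)
    (gx : Vec n → Vec m → Vec n) (ρ : ℝ) : Prop :=
  ∀ x x', ∀ y ∈ Y, ⟪gx x' y, x - x'⟫ - ρ / 2 * ‖x - x'‖ ^ 2 ≤ f x y - f x' y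

/-- The duality gap of the pair `(x₀, y₀)` on `f` is finite and at most `ε₀`. -/
def InitialGapLE {n m : ℕ} (Y : Set (Vec m)) (f : Vec n → Vec m → ℝ)
    (z₀ : Vec n × Vec m) (ε₀ : ℝ) : Prop :=
  z₀.2 ∈ Y ∧ BddBelow (Set.range fun x => f x z₀.2) ∧ gap Y f z₀ ≤ ε₀

/-! ### Stochastic gradients -/

/-- For a sample with law `ν`, `(Gx, Gy)` is an unbiased estimator of `(gx, gy)` at every point of
`ℝⁿ × Y`, both of its blocks having mean squared error at most `σ²`. -/
structure IsStochasticGradient {n m : ℕ} {Ξ : Type*} [MeasurableSpace Ξ] (Y : Set (Vec m))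
    (gx : Vec n → Vec m → Vec n) (gy : Vec n → Vec m → Vec m)
    (Gx : Vec n → Vec m → Ξ → Vec n) (Gy : Vec n → Vec m → Ξ → Vec m)
    (σ : ℝ) (ν : Measure Ξ) : Prop where
  memLpX : ∀ x, ∀ y ∈ Y, MemLp (Gx x y) 2 ν
  memLpY : ∀ x, ∀ y ∈ Y, MemLp (Gy x y) 2 ν
  unbiasedX : ∀ x, ∀ y ∈ Y, ∫ s, Gx x y s ∂ν = gx x y
  unbiasedY : ∀ x, ∀ y ∈ Y, ∫ s, Gy x y s ∂ν = gy x y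
  varianceX : ∀ x, ∀ y ∈ Y, ∫ s, ‖Gx x y s - gx x y‖ ^ 2 ∂ν ≤ σ ^ 2
  varianceY : ∀ x, ∀ y ∈ Y, ∫ s, ‖Gy x y s - gy x y‖ ^ 2 ∂ν ≤ σ ^ 2

/-- The stochastic gradient field `(∇ₓ fₖ, -∇_y fₖ)(z; s)` of the regularized objective
`f(x, y) + (γ / 2) ‖x - c‖²`, at the sample `s`. -/
def field {n m : ℕ} {Ξ : Type*} (Gx : Vec n → Vec m → Ξ → Vec n)
    (Gy : Vec n → Vec m → Ξ → Vec m) (γ : ℝ) (c : Vec n) (s : Ξ) (z : Vec n × Vec m) :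
    Vec n × Vec m :=
  (Gx z.1 z.2 s + γ • (z.1 - c), -Gy z.1 z.2 s)

/-! ### The algorithm -/

/-- `p` minimizes `z ↦ gᵀ z + ‖z - c‖² / 2` over `ℝⁿ × Y`. -/
def IsProx {n m : ℕ} (Y : Set (Vec m)) (c g p : Vec n × Vec m) : Prop :=
  p.2 ∈ Y ∧ ∀ z : Vec n × Vec m, z.2 ∈ Y →
    ⟪g.1, p.1⟫ + ⟪g.2, p.2⟫ + (‖p.1 - c.1‖ ^ 2 + ‖p.2 - c.2‖ ^ 2) / 2
      ≤ ⟪g.1, z.1⟫ + ⟪g.2, z.2⟫ + (‖z.1 - c.1‖ ^ 2 + ‖z.2 - c.2‖ ^ 2) / 2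

/-- `argmin_{z ∈ ℝⁿ × Y} gᵀ z + ‖z - c‖² / 2`: it exists and is unique for `Y` nonempty, closed
and convex. -/
def prox {n m : ℕ} (Y : Set (Vec m)) (c g : Vec n × Vec m) : Vec n × Vec m :=
  Classical.epsilon fun p => IsProx Y c g p

/-- The pair `(z_t, z̃_t)` of iterates of the optimistic gradient method with step size `η`, started
at `z₀`, where `G t` is the stochastic gradient field at the `t`-th sample. -/
def ogda {n m : ℕ} (Y : Set (Vec m)) (G : ℕ → Vec n × Vec m → Vec n × Vec m) (η : ℝ)
    (z₀ : Vec n × Vec m) : ℕ → (Vec n × Vec m) × (Vec n × Vec m)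
  | 0 => (z₀, z₀)
  | t + 1 =>
    let p := ogda Y G η z₀ t
    let z := prox Y p.2 (η • G t p.1)
    (z, prox Y p.2 (η • G (t + 1) z))

/-- The output `(1 / T) ∑_{t = 1}^T z_t` of the inner solver. -/
def ogdaAverage {n m : ℕ} (Y : Set (Vec m)) (G : ℕ → Vec n × Vec m → Vec n × Vec m) (η : ℝ)
    (T : ℕ) (z₀ : Vec n × Vec m) : Vec n × Vec m :=
  (T : ℝ)⁻¹ • ∑ t ∈ Finset.Icc 1 T, (ogda Y G η z₀ t).1

/-- The iterate `(x_k, y_k)` after `k` epochs of the proximal epoch method with the optimistic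
gradient inner solver.  Epoch `k ≥ 1` runs `T k` inner steps of size `η k` on the objective
regularized at the previous iterate, with the samples `s k 0, …, s k (T k)`. -/
def pes {n m : ℕ} {Ξ : Type*} (Y : Set (Vec m)) (Gx : Vec n → Vec m → Ξ → Vec n)
    (Gy : Vec n → Vec m → Ξ → Vec m) (γ : ℝ) (η : ℕ → ℝ) (T : ℕ → ℕ) (z₀ : Vec n × Vec m)
    (s : ℕ → ℕ → Ξ) : ℕ → Vec n × Vec m
  | 0 => z₀
  | k + 1 =>
    let z := pes Y Gx Gy γ η T z₀ s k
    ogdaAverage Y (fun t => field Gx Gy γ z.1 (s (k + 1) t)) (η (k + 1)) (T (k + 1)) z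

/-! ### Parameters and Lyapunov function -/

/-- Step size `η_k = η₀ exp(-(k - 1) / 16)` of epoch `k ≥ 1`. -/
def stepSize (η₀ : ℝ) (k : ℕ) : ℝ :=
  η₀ * Real.exp (-((k : ℝ) - 1) / 16)

/-- Number `T_k` of inner iterations of epoch `k ≥ 1`, rounded up to an integer. -/
def epochLength (η₀ μ μy : ℝ) (k : ℕ) : ℕ :=
  ⌈384 / (η₀ * min (μ / 8) μy) * Real.exp (((k : ℝ) - 1) / 16)⌉₊

/-- The Lyapunov function `475 (P(x) - P(x_*)) + 57 Gap(x, y)` at `z = (x, y)`, where the gap is that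
of `f` regularized at `x` itself. -/
def lyapunov {n m : ℕ} (Y : Set (Vec m)) (f : Vec n → Vec m → ℝ) (γ : ℝ) (xs : Vec n)
    (z : Vec n × Vec m) : ℝ :=
  475 * (primal Y f z.1 - primal Y f xs) + 57 * gap Y (regularized f γ z.1) z

/-- `K` epochs are enough for accuracy `ε`. -/
def EnoughEpochs (η₀ ε₀ σ ε : ℝ) (K : ℕ) : Prop :=
  max (16 * Real.log (1200 * ε₀ / ε)) (16 * Real.log (15600 * η₀ * K * σ ^ 2 / ε)) ≤ K

end PES

end

/-! Since `γ = μ/4` and `ρ ≤ μ/8`, the objective of an epoch is strongly convex in `x` with modulus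
at least `μ/8` and `μy`-strongly concave in `y`. The proof separates a pathwise inequality, in which
the noise is an arbitrary number, from the expectation of that number.

Inner solver. `optimisticGradient_regret` bounds the linearized regret against every comparator `p`
at once by `3‖z₀ - p‖²` plus terms free of `p`. Uniformity in `p` is essential: the duality gap uses
the best responses to the random output, so noise tested against `p` is not centred. A ghost
sequence driven by the noise absorbs that part. What remains is squared noise, and noise tested
against vectors known before the sample is drawn; the latter has mean zero, so
`EpochSetup.epochNoise_spec` bounds the mean by a multiple of `η σ²`. No boundedness of the domain
is needed, only second moments of the iterates.

Outer loop. Let `p`, `p'` be the primal gaps before and after an epoch, `g` and `g'` the regularized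
gaps at their own centres, `G` the gap of the inner problem at its output, `R = (γ/2)‖x - x₀‖²` and
`N` the noise. `IsSmoothNCSC.lyapunov_le` rests on three inequalities: `G ≤ (G + g)/64 + N`, from
the regret bound and quadratic growth around best responses; `p' + R ≤ p/2 + G`, from the
Polyak-Lojasiewicz inequality; and `g' ≤ 2G + 8R`, from moving the centre of the regularization. The
weights 475 and 57 make the coefficient of `R` nonpositive. The second inequality needs a point of
small objective close to `x₀`. `LSmooth.exists_near_min` finds it by gradient descent, whose path
length is paid for by the square root of the primal gap.

Complexity. The noise of an epoch is proportional to its step size, which decays at the contraction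
rate, so every epoch contributes equally to the final error; hence the factor `K`. The epoch lengths
grow geometrically, so their sum is comparable to the last one, and minimality of `K` bounds `exp((K
- 1)/16)` because `K - 1` epochs are not enough. -/

namespace PES

/-! ### Pathwise regret of the optimistic gradient method in a real inner product space. -/

section OptimisticGradient

variable {E : Type*} [NormedAddCommGroup E] [InnerProductSpace ℝ E]

/-- `p` is the projection of `c - g` onto `S`, as a variational inequality. -/
def IsProxPoint (S : Set E) (c g p : E) : Prop :=
  p ∈ S ∧ ∀ q ∈ S, 0 ≤ ⟪g + p - c, q - p⟫

lemma IsProxPoint.inner_sub_le {S : Set E} {c g p q : E} (h : IsProxPoint S c g p) (hq : q ∈ S) :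
    ⟪g, p - q⟫ ≤ (‖c - q‖ ^ 2 - ‖p - q‖ ^ 2 - ‖p - c‖ ^ 2) / 2 := by
  have h1 := h.2 q hq
  have e1 : ⟪g + p - c, q - p⟫ = -⟪g, p - q⟫ + ⟪p - c, q - p⟫ := by
    rw [add_sub_assoc, inner_add_left, ← neg_sub p q, inner_neg_right]
  have e2 : ‖c - q‖ ^ 2 = ‖p - c‖ ^ 2 + 2 * ⟪p - c, q - p⟫ + ‖p - q‖ ^ 2 := by
    rw [norm_sub_rev p q, ← norm_add_sq_real, norm_sub_rev c q]
    congr 2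
    abel
  linarith

/-- Firm nonexpansiveness of the projection: each variational inequality is tested at the other
point and the two are added. -/
lemma IsProxPoint.norm_sub_sq_le_inner {S : Set E} {c c' g g' p p' : E} (h : IsProxPoint S c g p)
    (h' : IsProxPoint S c' g' p') :
    ‖p - p'‖ ^ 2 ≤ ⟪(c - g) - (c' - g'), p - p'⟫ := by
  have h1 := h.2 p' h'.1
  have h2 := h'.2 p h.1
  have e : ⟪g + p - c, p' - p⟫ + ⟪g' + p' - c', p - p'⟫
      = ⟪(c - g) - (c' - g'), p - p'⟫ - ‖p - p'‖ ^ 2 := by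
    rw [← neg_sub p p', inner_neg_right, ← inner_neg_left, ← inner_add_left,
      ← real_inner_self_eq_norm_sq, ← inner_sub_left]
    congr 1
    abel
  linarith

lemma IsProxPoint.norm_sub_le {S : Set E} {c c' g g' p p' : E} (h : IsProxPoint S c g p)
    (h' : IsProxPoint S c' g' p') : ‖p - p'‖ ≤ ‖(c - g) - (c' - g')‖ := by
  have h1 := h.norm_sub_sq_le_inner h'
  have h2 := real_inner_le_norm ((c - g) - (c' - g')) (p - p')
  by_contra! hlt
  nlinarith [norm_nonneg (p - p'), norm_nonneg ((c - g) - (c' - g'))]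

lemma inner_le_young (x y : E) {r : ℝ} (hr : 0 < r) :
    ⟪x, y⟫ ≤ ‖x‖ ^ 2 / (4 * r) + r * ‖y‖ ^ 2 := by
  have h1 := real_inner_le_norm x y
  have h2 : ‖x‖ * ‖y‖ ≤ ‖x‖ ^ 2 / (4 * r) + r * ‖y‖ ^ 2 := by
    rw [← sub_nonneg]
    have : ‖x‖ ^ 2 / (4 * r) + r * ‖y‖ ^ 2 - ‖x‖ * ‖y‖ = (‖x‖ - 2 * r * ‖y‖) ^ 2 / (4 * r) := by
      field_simp
      ring
    rw [this]
    positivity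
  linarith

lemma norm_add_sq_le_weighted (x y : E) : ‖x + y‖ ^ 2 ≤ 9 / 4 * ‖x‖ ^ 2 + 9 / 5 * ‖y‖ ^ 2 := by
  have h1 := norm_add_sq_real x y
  have h2 := inner_le_young x y (r := 2 / 5) (by norm_num)
  norm_num at h2
  linarith

/-- One step of the stochastic optimistic gradient method.  `z'` is the previous iterate, `c` the
anchor, `z` the new iterate, `zt` the new anchor, and `zn` the anchor a noiseless step would give. -/
lemma optimisticGradient_step {S : Set E} {η Λ : ℝ} {c z' z zt zn F₀ F₁ θ₀ θ₁ p : E} (hη : 0 < η)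
    (hΛ : (η * Λ) ^ 2 ≤ 25 / 128)
    (hz : IsProxPoint S c (η • (F₀ + θ₀)) z) (hzt : IsProxPoint S c (η • (F₁ + θ₁)) zt)
    (hzn : IsProxPoint S c (η • F₁) zn) (hp : p ∈ S) (hF : ‖F₁ - F₀‖ ≤ Λ * ‖z - z'‖) :
    η * ⟪F₁, z - p⟫ ≤ (‖c - p‖ ^ 2 - ‖zt - p‖ ^ 2) / 2
      + 2 / 5 * (‖z' - c‖ ^ 2 - ‖z - zt‖ ^ 2)
      + η ^ 2 * (17 / 10 * ‖θ₁‖ ^ 2 + 23 / 5 * ‖θ₀‖ ^ 2)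
      + 17 / 10 * (η * ⟪θ₁, z - zn⟫) - η * ⟪θ₁, z - p⟫ := by
  have a1 := hzt.inner_sub_le hp
  have a2 := hz.inner_sub_le hzt.1
  have a3 := hz.norm_sub_sq_le_inner hzt
  have a4 := hzn.norm_sub_le hzt
  have e3 : (c - η • (F₀ + θ₀)) - (c - η • (F₁ + θ₁))
      = η • (F₁ - F₀) + (η • θ₁ - η • θ₀) := by
    simp only [smul_add, smul_sub]; abel
  have e4 : (c - η • F₁) - (c - η • (F₁ + θ₁)) = η • θ₁ := by
    simp only [smul_add]; abel
  rw [e3, inner_add_left, inner_sub_left] at a3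
  rw [e4] at a4
  have e1 : ⟪η • (F₁ + θ₁), zt - p⟫ = η * ⟪F₁, z - p⟫ + η * ⟪θ₁, z - p⟫
      - ⟪η • (F₁ + θ₁), z - zt⟫ := by
    simp only [inner_add_left, inner_sub_right, real_inner_smul_left]
    ring
  have e2 : ⟪η • (F₀ + θ₀), z - zt⟫ = ⟪η • (F₁ + θ₁), z - zt⟫
      - (⟪η • (F₁ - F₀), z - zt⟫ + (⟪η • θ₁, z - zt⟫ - ⟪η • θ₀, z - zt⟫)) := by
    simp only [inner_add_left, inner_sub_left, real_inner_smul_left]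
    ring
  -- noise of the current sample
  have b1 : ⟪η • θ₁, z - zt⟫ ≤ η * ⟪θ₁, z - zn⟫ + η ^ 2 * ‖θ₁‖ ^ 2 := by
    -- The noiseless anchor `zn` does not involve the current sample, so `⟪θ₁, z - zn⟫` will have
    -- mean zero; nonexpansiveness turns the difference between `zn` and `zt` into squared noise.
    have : ⟪η • θ₁, zn - zt⟫ ≤ η ^ 2 * ‖θ₁‖ ^ 2 := by
      refine (real_inner_le_norm _ _).trans ?_
      refine (mul_le_mul_of_nonneg_left a4 (norm_nonneg _)).trans ?_
      rw [norm_smul, Real.norm_of_nonneg hη.le]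
      exact le_of_eq (by ring)
    rw [← sub_add_sub_cancel z zn zt, inner_add_right, real_inner_smul_left θ₁ (z - zn) η]
    linarith
  -- noise of the previous sample
  have b2 : -⟪η • θ₀, z - zt⟫ ≤ η ^ 2 * ‖θ₀‖ ^ 2 / (4 * (17 / 184)) + 17 / 184 * ‖z - zt‖ ^ 2 := by
    have := inner_le_young (-(η • θ₀)) (z - zt) (r := 17 / 184) (by norm_num)
    rwa [inner_neg_left, norm_neg, norm_smul, Real.norm_of_nonneg hη.le, mul_pow] at this
  have b3 : ⟪η • (F₁ - F₀), z - zt⟫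
      ≤ η ^ 2 * ‖F₁ - F₀‖ ^ 2 / (4 * (3 / 8)) + 3 / 8 * ‖z - zt‖ ^ 2 := by
    have := inner_le_young (η • (F₁ - F₀)) (z - zt) (r := 3 / 8) (by norm_num)
    rwa [norm_smul, Real.norm_of_nonneg hη.le, mul_pow] at this
  have b4 : η ^ 2 * ‖F₁ - F₀‖ ^ 2 ≤ 25 / 128 * (9 / 4 * ‖z - c‖ ^ 2 + 9 / 5 * ‖z' - c‖ ^ 2) := by
    have h1 : ‖F₁ - F₀‖ ^ 2 ≤ (Λ * ‖z - z'‖) ^ 2 := pow_le_pow_left₀ (norm_nonneg _) hF 2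
    have h2 := norm_add_sq_le_weighted (z - c) (c - z')
    rw [sub_add_sub_cancel, norm_sub_rev c z'] at h2
    calc η ^ 2 * ‖F₁ - F₀‖ ^ 2 ≤ η ^ 2 * (Λ * ‖z - z'‖) ^ 2 := by gcongr
      _ = (η * Λ) ^ 2 * ‖z - z'‖ ^ 2 := by ring
      _ ≤ 25 / 128 * (9 / 4 * ‖z - c‖ ^ 2 + 9 / 5 * ‖z' - c‖ ^ 2) := by gcongr
  -- The combination is `a1 + a2 + (7/10) a3`: the coupling term gets weight `17/10` and `‖z - zt‖²`
  -- the coefficient `-6/5`. The Young weights are tuned so that `‖z - c‖²` is absorbed by the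
  -- `-1/2` from `a2`, while `‖z' - c‖²` and `‖z - zt‖²` are left with `2/5` and `-2/5`, which
  -- telescope.
  have n1 := sq_nonneg ‖z - c‖
  have n2 := sq_nonneg ‖z' - c‖
  have n3 := sq_nonneg ‖z - zt‖
  rw [norm_sub_rev c zt] at a2
  norm_num at b2 b3
  linarith

/-- The ghost sequence `w_{t+1} = w_t + (η / 5) θ_{t+1}` driven by the noise. -/
noncomputable def ghost (η : ℝ) (θ : ℕ → E) (w₀ : E) (t : ℕ) : E :=
  w₀ + (η / 5) • ∑ i ∈ Finset.range t, θ (i + 1)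

lemma ghost_succ (η : ℝ) (θ : ℕ → E) (w₀ : E) (t : ℕ) :
    ghost η θ w₀ (t + 1) = ghost η θ w₀ t + (η / 5) • θ (t + 1) := by
  simp only [ghost, Finset.sum_range_succ, smul_add, add_assoc]

/-- Expanding the square gives an identity valid for every `p`. Summed over the steps, it trades
noise tested against `p` for noise tested against the ghost point, at the cost of `5/2` of the
initial squared distance and `1/10` of the squared noise. -/
lemma ghost_step (η : ℝ) (w θ p : E) :
    -(η * ⟪θ, w - p⟫) = 5 / 2 * (‖w - p‖ ^ 2 - ‖w + (η / 5) • θ - p‖ ^ 2)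
      + η ^ 2 * (1 / 10 * ‖θ‖ ^ 2) := by
  rw [add_sub_right_comm, norm_add_sq_real, real_inner_smul_right, norm_smul, real_inner_comm θ,
    mul_pow, Real.norm_eq_abs, sq_abs]
  ring

/-- Pathwise regret bound of the stochastic optimistic gradient method. -/
theorem optimisticGradient_regret {S : Set E} {η Λ : ℝ} {z zt zn F θ : ℕ → E} (hη : 0 < η)
    (hΛ : (η * Λ) ^ 2 ≤ 25 / 128) (h0 : zt 0 = z 0)
    (hz : ∀ t, IsProxPoint S (zt t) (η • (F t + θ t)) (z (t + 1)))
    (hzt : ∀ t, IsProxPoint S (zt t) (η • (F (t + 1) + θ (t + 1))) (zt (t + 1)))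
    (hzn : ∀ t, IsProxPoint S (zt t) (η • F (t + 1)) (zn t))
    (hF : ∀ t, ‖F (t + 1) - F t‖ ≤ Λ * ‖z (t + 1) - z t‖) {p : E} (hp : p ∈ S) (T : ℕ) :
    η * ∑ t ∈ Finset.range T, ⟪F (t + 1), z (t + 1) - p⟫ ≤ 3 * ‖z 0 - p‖ ^ 2
      + ∑ t ∈ Finset.range T, (η ^ 2 * (9 / 5 * ‖θ (t + 1)‖ ^ 2 + 23 / 5 * ‖θ t‖ ^ 2)
        + η * ⟪θ (t + 1), (17 / 10 : ℝ) • (z (t + 1) - zn t)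
          - (z (t + 1) - ghost η θ (z 0) t)⟫) := by
  -- The induction needs the three nonpositive telescoping remainders. Initially `zt 0 = z 0`, so
  -- the distance terms sum to `1/2 + 5/2 = 3`.
  suffices H : η * ∑ t ∈ Finset.range T, ⟪F (t + 1), z (t + 1) - p⟫ ≤ 3 * ‖z 0 - p‖ ^ 2
      - ‖zt T - p‖ ^ 2 / 2 - 2 / 5 * ‖z T - zt T‖ ^ 2 - 5 / 2 * ‖ghost η θ (z 0) T - p‖ ^ 2
      + ∑ t ∈ Finset.range T, (η ^ 2 * (9 / 5 * ‖θ (t + 1)‖ ^ 2 + 23 / 5 * ‖θ t‖ ^ 2)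
        + η * ⟪θ (t + 1), (17 / 10 : ℝ) • (z (t + 1) - zn t)
          - (z (t + 1) - ghost η θ (z 0) t)⟫) by
    have n1 := sq_nonneg ‖zt T - p‖
    have n2 := sq_nonneg ‖z T - zt T‖
    have n3 := sq_nonneg ‖ghost η θ (z 0) T - p‖
    linarith
  induction T with
  | zero =>
    simp only [Finset.range_zero, Finset.sum_empty, h0, ghost, sub_self, norm_zero]
    simp
    linarith
  | succ T ih =>
    have h1 := optimisticGradient_step hη hΛ (hz T) (hzt T) (hzn T) hp (hF T)
    have h2 := ghost_step η (ghost η θ (z 0) T) (θ (T + 1)) p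
    rw [← ghost_succ] at h2
    rw [Finset.sum_range_succ, Finset.sum_range_succ, mul_add]
    have e : ⟪θ (T + 1), (17 / 10 : ℝ) • (z (T + 1) - zn T)
          - (z (T + 1) - ghost η θ (z 0) T)⟫ = 17 / 10 * ⟪θ (T + 1), z (T + 1) - zn T⟫
          - ⟪θ (T + 1), z (T + 1) - p⟫ + ⟪θ (T + 1), ghost η θ (z 0) T - p⟫ := by
      rw [inner_sub_right, real_inner_smul_right,
        ← sub_sub_sub_cancel_right (z (T + 1)) (ghost η θ (z 0) T) p, inner_sub_right (θ (T + 1)) (z (T + 1) - p)]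
      ring
    rw [e]
    linarith

end OptimisticGradient

/-! ### First order inequalities, existence of extrema and quadratic growth. -/

section Convexity

open Filter Topology

variable {F : Type*} [NormedAddCommGroup F] [InnerProductSpace ℝ F]

/-- Strong convexity along a segment yields quadratic growth at an extremum up to a factor tending
to 1 as `t` tends to 0; this removes the factor. -/
lemma le_of_forall_one_sub_sq_mul_le {A B : ℝ}
    (h : ∀ t : ℝ, 0 < t → t < 1 → (1 - t) ^ 2 * A ≤ B) : A ≤ B := by
  have h1 : Tendsto (fun t : ℝ => (1 - t) ^ 2 * A) (𝓝[>] 0) (𝓝 ((1 - 0) ^ 2 * A)) :=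
    ((by fun_prop : Continuous fun t : ℝ => (1 - t) ^ 2 * A).tendsto 0).mono_left
      nhdsWithin_le_nhds
  have h2 : ∀ᶠ t : ℝ in 𝓝[>] 0, (1 - t) ^ 2 * A ≤ B := by
    filter_upwards [Ioo_mem_nhdsGT (zero_lt_one' ℝ)] with t ht using h t ht.1 ht.2
  simpa using le_of_tendsto h1 h2

/-- The first order inequality of a concave function that is differentiable relative to its
domain. -/
lemma _root_.ConcaveOn.le_add_inner_gradientWithin [CompleteSpace F] {Y : Set F} {φ : F → ℝ}
    {g y y' : F} (hφ : ConcaveOn ℝ Y φ) (hg : HasGradientWithinAt φ g Y y) (hy : y ∈ Y)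
    (hy' : y' ∈ Y) : φ y' ≤ φ y + ⟪g, y' - y⟫ := by
  have hmaps : Set.MapsTo (fun t : ℝ => y + t • (y' - y)) (Set.Icc 0 1) Y := fun t ht => by
    have := hφ.1 hy hy' (sub_nonneg.2 ht.2) ht.1 (by ring)
    convert this using 1
    module
  have hline : HasDerivWithinAt (fun t : ℝ => y + t • (y' - y)) (y' - y) (Set.Icc 0 1) 0 := by
    simpa using (((hasDerivAt_id (0 : ℝ)).smul_const (y' - y)).const_add y).hasDerivWithinAt
  have hd : HasDerivWithinAt (φ ∘ fun t : ℝ => y + t • (y' - y)) ⟪g, y' - y⟫ (Set.Icc 0 1) 0 := by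
    have h1 : HasFDerivWithinAt φ (InnerProductSpace.toDual ℝ F g) Y
        ((fun t : ℝ => y + t • (y' - y)) 0) := by
      simpa using hg.hasFDerivWithinAt
    simpa using h1.comp_hasDerivWithinAt (0 : ℝ) hline hmaps
  have hd' := hasDerivWithinAt_iff_tendsto_slope.1 hd
  have hsub : 𝓝[>] (0 : ℝ) ≤ 𝓝[Set.Icc 0 1 \ {0}] 0 := by
    refine nhdsWithin_le_of_mem ?_
    filter_upwards [Ioo_mem_nhdsGT (zero_lt_one' ℝ)] with t ht
    exact ⟨⟨ht.1.le, ht.2.le⟩, ht.1.ne'⟩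
  -- By concavity every chord from `y` towards `y'` is at least as steep as the full chord; the
  -- one-sided limit of the slopes is the directional derivative, so `y` may lie on the boundary of
  -- `Y`.
  have hev : ∀ᶠ t : ℝ in 𝓝[>] 0,
      φ y' - φ y ≤ slope (φ ∘ fun t : ℝ => y + t • (y' - y)) 0 t := by
    filter_upwards [Ioo_mem_nhdsGT (zero_lt_one' ℝ)] with t ht
    have := hφ.2 hy hy' (sub_nonneg.2 ht.2.le) ht.1.le (by ring)
    have e : (1 - t) • y + t • y' = y + t • (y' - y) := by module
    rw [e, smul_eq_mul, smul_eq_mul] at this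
    rw [slope_def_field, sub_zero, le_div_iff₀ ht.1]
    simp only [Function.comp, zero_smul, add_zero]
    linarith
  linarith [ge_of_tendsto (hd'.mono_left hsub) hev]

/-- Adding `m/2 ‖·‖²` reduces this to the concave case, with gradient `g + m • y`. -/
lemma _root_.StrongConcaveOn.le_add_inner_gradientWithin [CompleteSpace F] {Y : Set F} {φ : F → ℝ}
    {g y y' : F} {m : ℝ} (hφ : StrongConcaveOn Y m φ) (hg : HasGradientWithinAt φ g Y y)
    (hy : y ∈ Y) (hy' : y' ∈ Y) : φ y' ≤ φ y + ⟪g, y' - y⟫ - m / 2 * ‖y' - y‖ ^ 2 := by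
  have hc := strongConcaveOn_iff_convex.1 hφ
  have hsq : HasGradientWithinAt (fun x : F => m / 2 * ‖x‖ ^ 2) (m • y) Y y := by
    have h1 : HasFDerivAt (fun x : F => m / 2 * ‖x‖ ^ 2) ((m / 2) • (2 • innerSL ℝ y)) y := by
      simpa using ((hasStrictFDerivAt_norm_sq y).hasFDerivAt).const_mul (m / 2)
    refine (hasGradientWithinAt_iff_hasFDerivWithinAt).2 ?_
    have e : InnerProductSpace.toDual ℝ F (m • y) = (m / 2) • (2 • innerSL ℝ y) := by
      ext v
      simp
      ring
    rw [e]
    exact h1.hasFDerivWithinAt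
  have hg' : HasGradientWithinAt (fun x => φ x + m / 2 * ‖x‖ ^ 2) (g + m • y) Y y := by
    refine (hasGradientWithinAt_iff_hasFDerivWithinAt).2 ?_
    rw [map_add]
    exact hg.hasFDerivWithinAt.add hsq.hasFDerivWithinAt
  have h := hc.le_add_inner_gradientWithin hg' hy hy'
  have e := norm_sub_sq_real y' y
  rw [inner_add_left, real_inner_smul_left, inner_sub_right y, real_inner_self_eq_norm_sq,
    real_inner_comm y' y] at h
  rw [e]
  linarith

/-- A strongly concave function that is differentiable relative to its closed domain has a
maximizer, from which it decreases quadratically. -/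
lemma _root_.StrongConcaveOn.exists_max [FiniteDimensional ℝ F] {Y : Set F} {φ : F → ℝ}
    {G : F → F} {m : ℝ} (hm : 0 < m) (hY : IsClosed Y) (hne : Y.Nonempty)
    (hφ : StrongConcaveOn Y m φ) (hg : ∀ y ∈ Y, HasGradientWithinAt φ (G y) Y y) :
    ∃ p ∈ Y, ∀ y ∈ Y, φ y + m / 2 * ‖y - p‖ ^ 2 ≤ φ p := by
  obtain ⟨y₀, hy₀⟩ := hne
  have hcont : ContinuousOn φ Y := fun y hy => (hg y hy).hasFDerivWithinAt.continuousWithinAt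
  -- Coercivity: beyond distance `2‖G y₀‖/m` from `y₀` the quadratic term of the first order bound
  -- dominates the linear one.
  obtain ⟨p, hp, hmax⟩ := hcont.exists_isMaxOn' hY hy₀ (by
    have h1 : (Metric.closedBall y₀ (2 * ‖G y₀‖ / m))ᶜ ∈ cocompact F :=
      (isCompact_closedBall y₀ _).compl_mem_cocompact
    filter_upwards [mem_inf_of_left h1, mem_inf_of_right (mem_principal_self Y)] with y hy hyY
    have h2 := hφ.le_add_inner_gradientWithin (hg y₀ hy₀) hy₀ hyY
    have h3 := real_inner_le_norm (G y₀) (y - y₀)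
    rw [Set.mem_compl_iff, Metric.mem_closedBall, dist_eq_norm, not_le, div_lt_iff₀ hm] at hy
    have h4 := norm_nonneg (y - y₀)
    nlinarith)
  refine ⟨p, hp, fun y hy => ?_⟩
  have key : m / 2 * ‖y - p‖ ^ 2 ≤ φ p - φ y := by
    refine le_of_forall_one_sub_sq_mul_le fun t ht ht1 => ?_
    have h1 := hφ.2 hp hy (sub_pos.2 ht1).le ht.le (by ring)
    have h2 : φ _ ≤ φ p := hmax (hφ.1 hp hy (sub_pos.2 ht1).le ht.le (by ring))
    simp only [smul_eq_mul, norm_sub_rev p y] at h1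
    have h3 : t * ((1 - t) * (m / 2 * ‖y - p‖ ^ 2)) ≤ t * (φ p - φ y) := by linarith
    have h4 := le_of_mul_le_mul_left h3 ht
    have h5 : 0 ≤ m / 2 * ‖y - p‖ ^ 2 := by positivity
    nlinarith [mul_nonneg (mul_nonneg ht.le (sub_pos.2 ht1).le) h5]
  linarith

/-- A function with a strongly convex first order minorant at every point has a minimizer, from
which it grows quadratically. -/
lemma exists_min_of_first_order [FiniteDimensional ℝ F] {h : F → ℝ} {d : F → F} {m : ℝ}
    (hm : 0 < m) (hc : Continuous h)
    (hd : ∀ x x', h x' + ⟪d x', x - x'⟫ + m / 2 * ‖x - x'‖ ^ 2 ≤ h x) :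
    ∃ p, ∀ x, h p + m / 2 * ‖x - p‖ ^ 2 ≤ h x := by
  obtain ⟨p, hp⟩ := hc.exists_forall_le' 0 (by
    have h1 : (Metric.closedBall (0 : F) (2 * ‖d 0‖ / m))ᶜ ∈ cocompact F :=
      (isCompact_closedBall 0 _).compl_mem_cocompact
    filter_upwards [h1] with y hy
    have h2 := hd y 0
    have h3 := neg_le_of_abs_le (abs_real_inner_le_norm (d 0) (y - 0))
    rw [Set.mem_compl_iff, Metric.mem_closedBall, dist_eq_norm, not_le, div_lt_iff₀ hm] at hy
    have h4 := norm_nonneg (y - 0)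
    nlinarith)
  refine ⟨p, fun x => ?_⟩
  have key : m / 2 * ‖x - p‖ ^ 2 ≤ h x - h p := by
    refine le_of_forall_one_sub_sq_mul_le fun t ht ht1 => ?_
    have h1 := hd p (p + t • (x - p))
    have h2 := hd x (p + t • (x - p))
    have h3 := hp (p + t • (x - p))
    have e1 : p - (p + t • (x - p)) = (-t) • (x - p) := by module
    have e2 : x - (p + t • (x - p)) = (1 - t) • (x - p) := by module
    rw [e1, real_inner_smul_right, norm_smul, mul_pow, Real.norm_eq_abs, sq_abs] at h1
    rw [e2, real_inner_smul_right, norm_smul, mul_pow, Real.norm_eq_abs, sq_abs] at h2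
    set r := ⟪d (p + t • (x - p)), x - p⟫
    have h5 : 0 ≤ m / 2 * ((-t) ^ 2 * ‖x - p‖ ^ 2) := by positivity
    -- The minorant at the intermediate point, evaluated at the minimizer `p`, forces the slope in
    -- the direction `x - p` to be nonnegative; it can then be dropped from the minorant evaluated
    -- at `x`.
    have h6 : 0 ≤ t * r := by linarith
    have h7 : 0 ≤ r := nonneg_of_mul_nonneg_right h6 ht
    nlinarith [mul_nonneg (sub_pos.2 ht1).le h7]
  linarith

end Convexity

/-! ### Path length of gradient descent under the Polyak-Lojasiewicz inequality. -/

section GradientDescent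

variable {n : ℕ} {P : Vec n → ℝ} {L : ℝ}

/-- Mean value theorem on the step: the gradient moves by at most `s L ‖∇P‖ ≤ ‖∇P‖/4`, so at least
`3/4` of the first order decrease survives. A short step makes this fraction large enough for the
distance bound of `LSmooth.exists_near_min`. -/
lemma LSmooth.descent (hP : LSmooth P L) (x : Vec n) {s : ℝ} (hs : 0 < s) (hL : s * L ≤ 1 / 4) :
    P (x - s • ∇ P x) ≤ P x - 3 / 4 * s * ‖∇ P x‖ ^ 2 := by
  set g := ∇ P x with hg
  have hder : ∀ t : ℝ, HasDerivAt (fun t : ℝ => P (x - t • g)) (-⟪∇ P (x - t • g), g⟫) t := by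
    intro t
    have h1 : HasFDerivAt P _ (x - t • g) := (hP.1 (x - t • g)).hasGradientAt.hasFDerivAt
    have h2 : HasDerivAt (fun t : ℝ => x - t • g) (-g) t := by
      simpa using ((hasDerivAt_id t).smul_const g).const_sub x
    have h3 := h1.comp_hasDerivAt t h2
    rw [InnerProductSpace.toDual_apply_apply, inner_neg_right] at h3
    exact h3
  obtain ⟨t, ht, he⟩ := exists_hasDerivAt_eq_slope (fun t : ℝ => P (x - t • g)) _ hs
    (fun t _ => (hder t).continuousAt.continuousWithinAt) (fun t _ => hder t)
  rw [eq_div_iff (by linarith)] at he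
  simp only [zero_smul, sub_zero] at he
  have h1 := hP.2 x (x - t • g)
  rw [sub_sub_cancel, norm_smul, Real.norm_of_nonneg ht.1.le, ← hg] at h1
  have h2 := real_inner_le_norm (g - ∇ P (x - t • g)) g
  rw [inner_sub_left, real_inner_self_eq_norm_sq] at h2
  have h3 : ‖g - ∇ P (x - t • g)‖ ≤ 1 / 4 * ‖g‖ := by
    refine h1.trans ?_
    have : L * t ≤ 1 / 4 := by
      rcases le_total L 0 with h | h
      · nlinarith [mul_nonneg (neg_nonneg.2 h) ht.1.le]
      · nlinarith [ht.2]
    nlinarith [norm_nonneg g]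
  have h4 : ‖g - ∇ P (x - t • g)‖ * ‖g‖ ≤ 1 / 4 * ‖g‖ ^ 2 := by nlinarith [norm_nonneg g]
  nlinarith

/-- Along a descent step, the square root of the optimality gap pays for the length of the step. -/
lemma sqrt_sub_sqrt_ge {p p' s G μ : ℝ} (hμ : 0 < μ) (hs : 0 < s) (hG : 0 ≤ G)
    (hp' : 0 ≤ p') (hd : p' ≤ p - 3 / 4 * s * G ^ 2) (hPL : 2 * μ * p ≤ G ^ 2) :
    3 / 4 * √(μ / 2) * (s * G) ≤ √p - √p' := by
  have hp : 0 ≤ p := by nlinarith [mul_nonneg hs.le (sq_nonneg G)]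
  have hle : √p' ≤ √p := Real.sqrt_le_sqrt (by nlinarith [mul_nonneg hs.le (sq_nonneg G)])
  set q := √p with hq
  set q' := √p' with hq'
  have e1 : q ^ 2 = p := Real.sq_sqrt hp
  have e2 : q' ^ 2 = p' := Real.sq_sqrt hp'
  have e3 : √(μ / 2) ^ 2 = μ / 2 := Real.sq_sqrt (by positivity)
  set m := √(μ / 2) with hm
  have hm0 : 0 ≤ m := Real.sqrt_nonneg _
  have hq0 : 0 ≤ q := Real.sqrt_nonneg _
  have hGm : 2 * m * q ≤ G := by
    refine abs_le_of_sq_le_sq' ?_ hG |>.2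
    nlinarith
  rcases eq_or_lt_of_le hq0 with h0 | h0
  · have : s * G ^ 2 ≤ 0 := by nlinarith [sq_nonneg q']
    have hG0 : G = 0 := by
      by_contra hne
      have : 0 < s * G ^ 2 := by positivity
      linarith
    rw [hG0]
    simpa using hle
  -- This is `q² - q'² ≤ 2q(q - q')`. One factor of `G` is then bounded below by `2mq` and `2q` is
  -- cancelled, which is why `q = 0` is treated apart.
  · have h1 : 3 / 4 * s * G ^ 2 ≤ (q - q') * (2 * q) := by nlinarith
    have h2 : 3 / 4 * s * G * (2 * m * q) ≤ 3 / 4 * s * G ^ 2 := by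
      have : 0 ≤ 3 / 4 * s * G := by positivity
      nlinarith
    have h3 : (3 / 4 * m * (s * G)) * (2 * q) ≤ (q - q') * (2 * q) := by nlinarith
    exact le_of_mul_le_mul_right h3 (by positivity)

/-- Under the Polyak-Lojasiewicz inequality there are points almost as good as the minimum whose
squared distance from `x₀` is controlled by the optimality gap at `x₀`. -/
lemma LSmooth.exists_near_min (hP : LSmooth P L) {μ pmin : ℝ} (hμ : 0 < μ)
    (hmin : ∀ x, pmin ≤ P x) (hPL : ∀ x, 2 * μ * (P x - pmin) ≤ ‖∇ P x‖ ^ 2) (x₀ : Vec n)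
    {δ : ℝ} (hδ : 0 < δ) :
    ∃ x, P x + μ / 8 * ‖x - x₀‖ ^ 2 ≤ pmin + (P x₀ - pmin) / 2 + δ := by
  obtain ⟨s, hs, hsL⟩ : ∃ s : ℝ, 0 < s ∧ s * L ≤ 1 / 4 := by
    refine ⟨1 / (4 * (|L| + 1)), by positivity, ?_⟩
    rw [div_mul_eq_mul_div, one_mul, div_le_div_iff₀ (by positivity) (by norm_num)]
    linarith [le_abs_self L]
  let X : ℕ → Vec n := fun j => (fun x => x - s • ∇ P x)^[j] x₀
  have hX0 : X 0 = x₀ := rfl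
  have hX : ∀ j, X (j + 1) = X j - s • ∇ P (X j) := fun j => Function.iterate_succ_apply' _ _ _
  have hdes : ∀ j, P (X (j + 1)) ≤ P (X j) - 3 / 4 * s * ‖∇ P (X j)‖ ^ 2 := fun j => by
    rw [hX]; exact hP.descent (X j) hs hsL
  have hdist : ∀ j, 3 / 4 * √(μ / 2) * ‖X j - x₀‖ ≤ √(P x₀ - pmin) - √(P (X j) - pmin) := by
    intro j
    induction j with
    | zero => simp [hX0]
    | succ j ih =>
      have h1 := sqrt_sub_sqrt_ge (p := P (X j) - pmin) (p' := P (X (j + 1)) - pmin) hμ hs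
        (norm_nonneg (∇ P (X j))) (sub_nonneg.2 (hmin _)) (by linarith [hdes j]) (hPL (X j))
      have h2 : ‖X (j + 1) - x₀‖ ≤ ‖X j - x₀‖ + s * ‖∇ P (X j)‖ := by
        rw [hX, sub_right_comm]
        refine (norm_sub_le _ _).trans ?_
        rw [norm_smul, Real.norm_of_nonneg hs.le]
      have h3 := mul_le_mul_of_nonneg_left h2 (by positivity : (0 : ℝ) ≤ 3 / 4 * √(μ / 2))
      linarith
  -- While the gap is at least `δ`, each step decreases it by at least the fixed amount `(3/2) s μ
  -- δ`.
  obtain ⟨j, hj⟩ : ∃ j, P (X j) - pmin < δ := by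
    by_contra! hcon
    have hlin : ∀ j : ℕ, P (X j) - pmin ≤ P x₀ - pmin - j * (3 / 2 * s * μ * δ) := by
      intro j
      induction j with
      | zero => simp [hX0]
      | succ j ih =>
        have h1 := hdes j
        have h2 := hPL (X j)
        have h3 : 2 * μ * δ ≤ ‖∇ P (X j)‖ ^ 2 := by nlinarith [hcon j]
        have h4 := mul_le_mul_of_nonneg_left h3 hs.le
        push_cast
        linarith
    obtain ⟨j, hj⟩ := exists_nat_gt ((P x₀ - pmin) / (3 / 2 * s * μ * δ))
    rw [div_lt_iff₀ (by positivity)] at hj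
    linarith [hlin j, hmin (X j)]
  refine ⟨X j, ?_⟩
  have h1 : 3 / 4 * √(μ / 2) * ‖X j - x₀‖ ≤ √(P x₀ - pmin) :=
    (hdist j).trans (by linarith [Real.sqrt_nonneg (P (X j) - pmin)])
  -- Squaring gives `(9/32) μ ‖X j - x₀‖² ≤ P x₀ - pmin`, so the penalty `μ/8 ‖X j - x₀‖²` is at
  -- most `4/9` of the initial gap.
  have h2 := pow_le_pow_left₀ (by positivity) h1 2
  rw [Real.sq_sqrt (sub_nonneg.2 (hmin _)), mul_pow, mul_pow,
    Real.sq_sqrt (by positivity : (0 : ℝ) ≤ μ / 2)] at h2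
  nlinarith [mul_nonneg hμ.le (sq_nonneg ‖X j - x₀‖)]

end GradientDescent

/-! ### Duality gaps of the regularized objective and the deterministic Lyapunov inequality. -/

section DualityGap

variable {n m : ℕ} {Y : Set (Vec m)} {f : Vec n → Vec m → ℝ} {gx : Vec n → Vec m → Vec n}
  {gy : Vec n → Vec m → Vec m} {ℓ μy L ρ γ : ℝ}

lemma IsSmoothNCSC.le_add_inner_gradY (h : IsSmoothNCSC Y f gx gy ℓ μy L) (hμy : 0 ≤ μy)
    (x : Vec n) {y y' : Vec m} (hy : y ∈ Y) (hy' : y' ∈ Y) :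
    f x y' ≤ f x y + ⟪gy x y, y' - y⟫ := by
  have h1 := (h.strongConcave x).le_add_inner_gradientWithin (h.hasGradientY x y hy) hy hy'
  have h2 : 0 ≤ μy / 2 * ‖y' - y‖ ^ 2 := by positivity
  linarith

/-- The square `γ/2 ‖x - c‖²` is expanded around `x'`: its linear part joins the gradient and its
curvature `γ` outweighs the weak convexity `ρ`. -/
lemma WeaklyConvexX.regularized_ge (hw : WeaklyConvexX Y f gx ρ) (c x x' : Vec n) {y : Vec m}
    (hy : y ∈ Y) :
    regularized f γ c x' y + ⟪gx x' y + γ • (x' - c), x - x'⟫ + (γ - ρ) / 2 * ‖x - x'‖ ^ 2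
      ≤ regularized f γ c x y := by
  have h1 := hw x x' y hy
  have e : ‖x - c‖ ^ 2 = ‖x - x'‖ ^ 2 + 2 * ⟪x' - c, x - x'⟫ + ‖x' - c‖ ^ 2 := by
    rw [← sub_add_sub_cancel x x' c, norm_add_sq_real, real_inner_comm]
  simp only [regularized]
  rw [e, inner_add_left, real_inner_smul_left]
  linarith

lemma IsSmoothNCSC.exists_primal_eq (h : IsSmoothNCSC Y f gx gy ℓ μy L) (hμy : 0 < μy)
    (hne : Y.Nonempty) (x : Vec n) :
    ∃ p ∈ Y, primal Y f x = f x p ∧ ∀ y ∈ Y, f x y + μy / 2 * ‖y - p‖ ^ 2 ≤ f x p := by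
  obtain ⟨p, hp, hmax⟩ := (h.strongConcave x).exists_max hμy h.isClosed hne (h.hasGradientY x)
  refine ⟨p, hp, IsGreatest.csSup_eq ⟨⟨p, hp, rfl⟩, ?_⟩, hmax⟩
  rintro _ ⟨y, hy, rfl⟩
  have : 0 ≤ μy / 2 * ‖y - p‖ ^ 2 := by positivity
  linarith [hmax y hy]

lemma IsSmoothNCSC.le_primal (h : IsSmoothNCSC Y f gx gy ℓ μy L) (hμy : 0 < μy)
    (x : Vec n) {y : Vec m} (hy : y ∈ Y) : f x y ≤ primal Y f x := by
  obtain ⟨p, -, he, hp⟩ := h.exists_primal_eq hμy ⟨y, hy⟩ x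
  have : 0 ≤ μy / 2 * ‖y - p‖ ^ 2 := by positivity
  linarith [hp y hy]

lemma IsSmoothNCSC.primal_regularized (h : IsSmoothNCSC Y f gx gy ℓ μy L) (hμy : 0 < μy)
    (hne : Y.Nonempty) (c x : Vec n) :
    primal Y (regularized f γ c) x = primal Y f x + γ / 2 * ‖x - c‖ ^ 2 := by
  obtain ⟨p, hp, he, hmax⟩ := h.exists_primal_eq hμy hne x
  refine IsGreatest.csSup_eq ⟨⟨p, hp, by simp only [regularized, he]⟩, ?_⟩
  rintro _ ⟨y, hy, rfl⟩
  simp only [regularized]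
  linarith [h.le_primal hμy x hy]

/-- The duality gap of the regularized objective is attained, with quadratic growth around the
best responses. -/
lemma IsSmoothNCSC.exists_gap_eq (h : IsSmoothNCSC Y f gx gy ℓ μy L) (hμy : 0 < μy)
    (hw : WeaklyConvexX Y f gx ρ) (hργ : ρ < γ) (c x : Vec n) {y : Vec m} (hy : y ∈ Y) :
    ∃ x', gap Y (regularized f γ c) (x, y)
        = primal Y f x + γ / 2 * ‖x - c‖ ^ 2 - (f x' y + γ / 2 * ‖x' - c‖ ^ 2) ∧
      ∀ u, f x' y + γ / 2 * ‖x' - c‖ ^ 2 + (γ - ρ) / 2 * ‖u - x'‖ ^ 2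
        ≤ f u y + γ / 2 * ‖u - c‖ ^ 2 := by
  have hcont : Continuous fun u => regularized f γ c u y := by
    have : Continuous fun u => f u y := continuous_iff_continuousAt.2 fun u =>
      (h.hasGradientX u y hy).hasFDerivAt.continuousAt
    unfold regularized
    fun_prop
  obtain ⟨x', hx'⟩ := exists_min_of_first_order (sub_pos.2 hργ) hcont
    fun u u' => hw.regularized_ge (γ := γ) c u u' hy
  refine ⟨x', ?_, hx'⟩
  have hmin : sInf (Set.range fun u => regularized f γ c u y) = regularized f γ c x' y := by
    refine IsLeast.csInf_eq ⟨⟨x', rfl⟩, ?_⟩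
    rintro _ ⟨u, rfl⟩
    have : 0 ≤ (γ - ρ) / 2 * ‖u - x'‖ ^ 2 :=
      mul_nonneg (by linarith [sub_pos.2 hργ]) (sq_nonneg _)
    linarith [hx' u]
  rw [gap, h.primal_regularized hμy ⟨y, hy⟩]
  simp only [hmin]
  rfl

lemma IsSmoothNCSC.le_gap (h : IsSmoothNCSC Y f gx gy ℓ μy L) (hμy : 0 < μy)
    (hw : WeaklyConvexX Y f gx ρ) (hργ : ρ < γ) (c x u : Vec n) {y : Vec m} (hy : y ∈ Y) :
    primal Y f x + γ / 2 * ‖x - c‖ ^ 2 - (f u y + γ / 2 * ‖u - c‖ ^ 2)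
      ≤ gap Y (regularized f γ c) (x, y) := by
  obtain ⟨x', he, hx'⟩ := h.exists_gap_eq hμy hw hργ c x hy
  have : 0 ≤ (γ - ρ) / 2 * ‖u - x'‖ ^ 2 := mul_nonneg (by linarith [sub_pos.2 hργ]) (sq_nonneg _)
  linarith [hx' u]

lemma IsSmoothNCSC.gap_nonneg (h : IsSmoothNCSC Y f gx gy ℓ μy L) (hμy : 0 < μy)
    (hw : WeaklyConvexX Y f gx ρ) (hργ : ρ < γ) (c x : Vec n) {y : Vec m} (hy : y ∈ Y) :
    0 ≤ gap Y (regularized f γ c) (x, y) := by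
  linarith [h.le_gap hμy hw hργ c x x hy, h.le_primal hμy x hy]

/-- The squared distance from `(x₀, y₀)` to the best responses to `(x, y)` is controlled by the
duality gaps of both pairs. -/
lemma IsSmoothNCSC.exists_best_response (h : IsSmoothNCSC Y f gx gy ℓ μy L) (hμy : 0 < μy)
    (hw : WeaklyConvexX Y f gx ρ) (hργ : ρ < γ) {α : ℝ} (hα : α ≤ γ - ρ) (hα' : α ≤ μy)
    (x₀ x : Vec n) {y₀ y : Vec m} (hy₀ : y₀ ∈ Y) (hy : y ∈ Y) :
    ∃ x', ∃ y' ∈ Y,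
      gap Y (regularized f γ x₀) (x, y) = regularized f γ x₀ x y' - regularized f γ x₀ x' y ∧
      α / 2 * (‖x' - x₀‖ ^ 2 + ‖y' - y₀‖ ^ 2)
        ≤ gap Y (regularized f γ x₀) (x, y) + gap Y (regularized f γ x₀) (x₀, y₀) := by
  obtain ⟨x', he, hx'⟩ := h.exists_gap_eq hμy hw hργ x₀ x hy
  obtain ⟨y', hy', he', hmax⟩ := h.exists_primal_eq hμy ⟨y, hy⟩ x
  refine ⟨x', y', hy', by rw [he, he']; rfl, ?_⟩
  -- Growth in `x` at `x'` and in `y` at `y'` bounds the distances by `G + f_k(x₀, y) - f_k(x, y₀)`.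
  -- The last difference is at most the gap at `(x₀, y₀)`, by `h3` and `h4`.
  have h1 := hx' x₀
  have h2 := hmax y₀ hy₀
  have h3 := h.le_gap hμy hw hργ x₀ x₀ x hy₀
  have h4 := h.le_primal hμy x₀ hy
  have h5 := mul_le_mul_of_nonneg_right hα (sq_nonneg ‖x' - x₀‖)
  have h6 := mul_le_mul_of_nonneg_right hα' (sq_nonneg ‖y' - y₀‖)
  rw [norm_sub_rev x₀ x'] at h1
  rw [norm_sub_rev y₀ y'] at h2
  simp only [sub_self, norm_zero] at h1 h3
  linarith

lemma IsSmoothNCSC.lyapunov_nonneg (h : IsSmoothNCSC Y f gx gy ℓ μy L) (hμy : 0 < μy)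
    (hw : WeaklyConvexX Y f gx ρ) (hργ : ρ < γ) {xs : Vec n}
    (hxs : ∀ x, primal Y f xs ≤ primal Y f x) {z : Vec n × Vec m} (hz : z.2 ∈ Y) :
    0 ≤ lyapunov Y f γ xs z := by
  have h1 := h.gap_nonneg hμy hw hργ z.1 z.1 hz
  have h2 := hxs z.1
  have e : lyapunov Y f γ xs z = 475 * (primal Y f z.1 - primal Y f xs)
    + 57 * gap Y (regularized f γ z.1) (z.1, z.2) := rfl
  rw [e]
  linarith

/-- An approximate saddle point of the regularized objective improves the Lyapunov function. -/
theorem IsSmoothNCSC.lyapunov_le (h : IsSmoothNCSC Y f gx gy ℓ μy L) (hμy : 0 < μy)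
    (hw : WeaklyConvexX Y f gx ρ) {μ : ℝ} (hμ : 0 < μ) (hρ : ρ ≤ μ / 8) {xs : Vec n}
    (hxs : ∀ x, primal Y f xs ≤ primal Y f x) (hPL : PLCondition (primal Y f) μ)
    {z z' : Vec n × Vec m} (hz : z.2 ∈ Y) (hz' : z'.2 ∈ Y) {a N : ℝ}
    (ha : a ≤ min (μ / 8) μy / 128)
    (hreg : ∀ x, ∀ y ∈ Y, regularized f (μ / 4) z.1 z'.1 y - regularized f (μ / 4) z.1 x z'.2
      ≤ a * (‖x - z.1‖ ^ 2 + ‖y - z.2‖ ^ 2) + N) :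
    lyapunov Y f (μ / 4) xs z'
      ≤ Real.exp (-1 / 16) * lyapunov Y f (μ / 4) xs z + 589 * 64 / 63 * N := by
  obtain ⟨x₀, y₀⟩ := z
  obtain ⟨x, y⟩ := z'
  simp only at hz hz' hreg
  simp only [lyapunov]
  have hργ : ρ < μ / 4 := by linarith
  set p := primal Y f x₀ - primal Y f xs with hp
  set p' := primal Y f x - primal Y f xs with hp'
  have hp0 : 0 ≤ p := sub_nonneg.2 (hxs x₀)
  set G := gap Y (regularized f (μ / 4) x₀) (x, y) with hG
  set g := gap Y (regularized f (μ / 4) x₀) (x₀, y₀) with hg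
  set g' := gap Y (regularized f (μ / 4) x) (x, y) with hg'
  have hg0 : 0 ≤ g := h.gap_nonneg hμy hw hργ x₀ x₀ hz
  set R := μ / 8 * ‖x - x₀‖ ^ 2 with hR
  -- the inner gap
  have hGle : G ≤ (G + g) / 64 + N := by
    -- The regret bound is used at the best responses, where its left side is `G`. As `a ≤ α/128`
    -- and `hD` carries `α/2`, the distance term costs at most `(G + g)/64`.
    obtain ⟨u, v, hv, he, hD⟩ := h.exists_best_response hμy hw hργ (α := min (μ / 8) μy)
      (by linarith [min_le_left (μ / 8) μy]) (min_le_right _ _) x₀ x hz hz'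
    have h1 := hreg u v hv
    have h2 := mul_le_mul_of_nonneg_right ha
      (by positivity : 0 ≤ ‖u - x₀‖ ^ 2 + ‖v - y₀‖ ^ 2)
    linarith
  -- the primal gap
  have hp'le : p' + R ≤ p / 2 + G := by
    -- The near-minimizer serves as competitor in the gap; its penalty weight `μ/8` is exactly
    -- `γ/2`.
    refine le_of_forall_pos_le_add fun δ hδ => ?_
    obtain ⟨u, hu⟩ := h.primal_smooth.exists_near_min hμ hxs (hPL xs hxs) x₀ hδ
    have h1 := h.le_gap hμy hw hργ x₀ x u hz'
    have h2 := h.le_primal hμy u hz'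
    linarith
  -- the gap of the next regularization
  have hg'le : g' ≤ 2 * G + 8 * R := by
    obtain ⟨v, he, hv⟩ := h.exists_gap_eq hμy hw hργ x x hz'
    have h1 := h.le_gap hμy hw hργ x₀ x v hz'
    have h2 := hv x
    have h3 := h.le_primal hμy x hz'
    -- After the weights `5/4` and `5`, an excess `μ/32 ‖v - x‖²` is left. Quadratic growth around
    -- `v` gives `g' ≥ μ/16 ‖v - x‖²`, so half of `g'` absorbs it.
    have h4 : ‖v - x₀‖ ^ 2 ≤ 5 / 4 * ‖v - x‖ ^ 2 + 5 * ‖x - x₀‖ ^ 2 := by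
      have h5 := inner_le_young (v - x) (x - x₀) (r := 2) (by norm_num)
      rw [← sub_add_sub_cancel v x x₀, norm_add_sq_real]
      linarith
    have h5 : μ / 8 * ‖v - x‖ ^ 2 ≤ (μ / 4 - ρ) * ‖v - x‖ ^ 2 :=
      mul_le_mul_of_nonneg_right (by linarith) (sq_nonneg _)
    have h6 := mul_le_mul_of_nonneg_left h4 hμ.le
    rw [norm_sub_rev x v] at h2
    simp only [sub_self, norm_zero] at he h2
    linarith
  -- In `475 (p/2 + G - R) + 57 (2G + 8R)` the coefficient of `R` is `456 - 475 < 0` and that of `G`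
  -- is 589. Inserting `G ≤ (g + 64N)/63` leaves multiples of `p` and `g` below `15/16` of 475 and
  -- 57.
  have hexp : 15 / 16 ≤ Real.exp (-1 / 16) := by
    linarith [Real.add_one_le_exp (-1 / 16 : ℝ)]
  have hΔ : 0 ≤ 475 * p + 57 * g := by positivity
  have hR0 : 0 ≤ R := by positivity
  have := mul_le_mul_of_nonneg_right hexp hΔ
  linarith

end DualityGap

/-- `ℝⁿ × ℝᵐ` with the Euclidean norm of pairs. -/
abbrev Pair (n m : ℕ) : Type := WithLp 2 (Vec n × Vec m)

/-! ### The proximal map as a projection in the Euclidean product. -/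

section Prox

variable {n m : ℕ} {Y : Set (Vec m)}

lemma norm_toLp_sq (z : Vec n × Vec m) :
    ‖(WithLp.toLp 2 z : Pair n m)‖ ^ 2 = ‖z.1‖ ^ 2 + ‖z.2‖ ^ 2 :=
  WithLp.prod_norm_sq_eq_of_L2 _

lemma inner_toLp (z z' : Vec n × Vec m) :
    ⟪(WithLp.toLp 2 z : Pair n m), WithLp.toLp 2 z'⟫ = ⟪z.1, z'.1⟫ + ⟪z.2, z'.2⟫ :=
  WithLp.prod_inner_apply _ _

/-- The set `ℝⁿ × Y`. -/
def feasible (n : ℕ) (Y : Set (Vec m)) : Set (Pair n m) := {z | z.snd ∈ Y}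

lemma isProx_iff (c g p : Vec n × Vec m) :
    IsProx Y c g p ↔ p.2 ∈ Y ∧ ∀ z : Vec n × Vec m, z.2 ∈ Y →
      ⟪(WithLp.toLp 2 g : Pair n m), WithLp.toLp 2 p⟫
          + ‖(WithLp.toLp 2 p - WithLp.toLp 2 c : Pair n m)‖ ^ 2 / 2
        ≤ ⟪(WithLp.toLp 2 g : Pair n m), WithLp.toLp 2 z⟫
          + ‖(WithLp.toLp 2 z - WithLp.toLp 2 c : Pair n m)‖ ^ 2 / 2 := by
  simp only [IsProx, ← WithLp.toLp_sub, norm_toLp_sq, inner_toLp, Prod.fst_sub, Prod.snd_sub]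

/-- The problem decouples: an unconstrained step in `x` and a projection onto `Y` in `y`. -/
lemma exists_isProxPoint (hY : IsClosed Y) (hc : Convex ℝ Y) (hne : Y.Nonempty)
    (c g : Vec n × Vec m) :
    ∃ p : Vec n × Vec m,
      IsProxPoint (feasible n Y) (WithLp.toLp 2 c) (WithLp.toLp 2 g) (WithLp.toLp 2 p) := by
  obtain ⟨v, hv, he⟩ := exists_norm_eq_iInf_of_complete_convex hne hY.isComplete hc (c.2 - g.2)
  rw [norm_eq_iInf_iff_real_inner_le_zero hc hv] at he
  refine ⟨(c.1 - g.1, v), hv, fun q hq => ?_⟩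
  have e : (WithLp.toLp 2 g + WithLp.toLp 2 (c.1 - g.1, v) - WithLp.toLp 2 c : Pair n m)
      = WithLp.toLp 2 (0, -(c.2 - g.2 - v)) := by
    rw [← WithLp.toLp_add, ← WithLp.toLp_sub]
    congr 1
    ext1
    · simp
    · simp only [Prod.snd_sub, Prod.snd_add]; abel
  have e' : q - WithLp.toLp 2 (c.1 - g.1, v)
      = WithLp.toLp 2 (q.fst - (c.1 - g.1), q.snd - v) := rfl
  rw [e, e', inner_toLp, inner_zero_left, zero_add, inner_neg_left]
  linarith [he q.snd hq]

lemma IsProxPoint.objective_add_le {E : Type*} [NormedAddCommGroup E] [InnerProductSpace ℝ E]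
    {S : Set E} {c g p q : E} (h : IsProxPoint S c g p) (hq : q ∈ S) :
    ⟪g, p⟫ + ‖p - c‖ ^ 2 / 2 + ‖q - p‖ ^ 2 / 2 ≤ ⟪g, q⟫ + ‖q - c‖ ^ 2 / 2 := by
  have h1 := h.inner_sub_le hq
  rw [norm_sub_rev c q, norm_sub_rev p q, inner_sub_right] at h1
  linarith

/-- The solution of the variational inequality minimizes with quadratic growth, so any minimizer, in
particular the chosen one, coincides with it. -/
lemma isProxPoint_prox (hY : IsClosed Y) (hc : Convex ℝ Y) (hne : Y.Nonempty)
    (c g : Vec n × Vec m) :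
    IsProxPoint (feasible n Y) (WithLp.toLp 2 c) (WithLp.toLp 2 g)
      (WithLp.toLp 2 (prox Y c g)) := by
  obtain ⟨p, hp⟩ := exists_isProxPoint hY hc hne c g
  have hex : ∃ p, IsProx Y c g p := by
    refine ⟨p, (isProx_iff c g p).2 ⟨hp.1, fun z hz => ?_⟩⟩
    have h1 := hp.objective_add_le (q := WithLp.toLp 2 z) hz
    have h2 := sq_nonneg ‖(WithLp.toLp 2 z - WithLp.toLp 2 p : Pair n m)‖
    linarith
  have hs : IsProx Y c g (prox Y c g) := Classical.epsilon_spec hex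
  rw [isProx_iff] at hs
  have h1 := hs.2 p hp.1
  have h2 := hp.objective_add_le (q := WithLp.toLp 2 (prox Y c g)) hs.1
  have h3 : ‖(WithLp.toLp 2 (prox Y c g) - WithLp.toLp 2 p : Pair n m)‖ = 0 := by
    refine pow_eq_zero_iff two_ne_zero |>.1 (le_antisymm ?_ (sq_nonneg _))
    linarith
  rwa [sub_eq_zero.1 (norm_eq_zero.1 h3)]

lemma prox_mem (hY : IsClosed Y) (hc : Convex ℝ Y) (hne : Y.Nonempty) (c g : Vec n × Vec m) :
    (prox Y c g).2 ∈ Y :=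
  (isProxPoint_prox hY hc hne c g).1

lemma norm_prox_sub_le (hY : IsClosed Y) (hc : Convex ℝ Y) (hne : Y.Nonempty)
    (c g c' g' : Vec n × Vec m) :
    ‖(WithLp.toLp 2 (prox Y c g) - WithLp.toLp 2 (prox Y c' g') : Pair n m)‖
      ≤ ‖(WithLp.toLp 2 (c - g) - WithLp.toLp 2 (c' - g') : Pair n m)‖ := by
  simpa only [WithLp.toLp_sub] using
    (isProxPoint_prox hY hc hne c g).norm_sub_le (isProxPoint_prox hY hc hne c' g')

/-- Nonexpansiveness gives continuity, and hence measurability of a map defined by choice. -/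
lemma continuous_prox (hY : IsClosed Y) (hc : Convex ℝ Y) (hne : Y.Nonempty) :
    Continuous fun q : (Vec n × Vec m) × (Vec n × Vec m) => prox Y q.1 q.2 := by
  have hlp : Continuous (WithLp.toLp 2 : Vec n × Vec m → Pair n m) :=
    WithLp.prod_continuous_toLp _ _ _
  suffices h : Continuous fun q : (Vec n × Vec m) × (Vec n × Vec m) =>
      (WithLp.toLp 2 (prox Y q.1 q.2) : Pair n m) from
    (WithLp.prod_continuous_ofLp 2 (Vec n) (Vec m)).comp h
  refine continuous_iff_continuousAt.2 fun q => tendsto_iff_norm_sub_tendsto_zero.2 ?_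
  have h1 : Continuous fun r : (Vec n × Vec m) × (Vec n × Vec m) =>
      ‖(WithLp.toLp 2 (r.1 - r.2) - WithLp.toLp 2 (q.1 - q.2) : Pair n m)‖ := by fun_prop
  refine squeeze_zero (fun _ => norm_nonneg _)
    (fun r => norm_prox_sub_le hY hc hne r.1 r.2 q.1 q.2) ?_
  simpa using h1.tendsto q

end Prox

/-! ### Pathwise guarantee of one epoch. -/

section Epoch

variable {n m : ℕ} {Ξ : Type*} {Y : Set (Vec m)} {f : Vec n → Vec m → ℝ}
  {gx : Vec n → Vec m → Vec n} {gy : Vec n → Vec m → Vec m} {Gx : Vec n → Vec m → Ξ → Vec n}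
  {Gy : Vec n → Vec m → Ξ → Vec m} {ℓ μy L ρ γ η : ℝ}

/-- The exact gradient field of the regularized objective. -/
noncomputable def meanField (gx : Vec n → Vec m → Vec n) (gy : Vec n → Vec m → Vec m) (γ : ℝ) (c : Vec n)
    (z : Vec n × Vec m) : Vec n × Vec m :=
  (gx z.1 z.2 + γ • (z.1 - c), -gy z.1 z.2)

/-- The error of the stochastic gradient field. -/
noncomputable def gradNoise (gx : Vec n → Vec m → Vec n) (gy : Vec n → Vec m → Vec m)
    (Gx : Vec n → Vec m → Ξ → Vec n) (Gy : Vec n → Vec m → Ξ → Vec m) (z : Vec n × Vec m)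
    (s : Ξ) : Pair n m :=
  WithLp.toLp 2 (Gx z.1 z.2 s - gx z.1 z.2, gy z.1 z.2 - Gy z.1 z.2 s)

lemma toLp_field (c : Vec n) (s : Ξ) (z : Vec n × Vec m) :
    (WithLp.toLp 2 (field Gx Gy γ c s z) : Pair n m)
      = WithLp.toLp 2 (meanField gx gy γ c z) + gradNoise gx gy Gx Gy z s := by
  rw [gradNoise, ← WithLp.toLp_add]
  congr 1
  ext1
  · simp only [field, meanField, Prod.fst_add]; abel
  · simp only [field, meanField, Prod.snd_add]; abel

/-- With `γ = 0` the centre plays no role, so the two centres may differ. -/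
lemma IsSmoothNCSC.meanField_zero_lipschitz (h : IsSmoothNCSC Y f gx gy ℓ μy L) (hℓ : 0 ≤ ℓ)
    (c c' : Vec n) {z z' : Vec n × Vec m} (hz : z.2 ∈ Y) (hz' : z'.2 ∈ Y) :
    ‖(WithLp.toLp 2 (meanField gx gy 0 c z) - WithLp.toLp 2 (meanField gx gy 0 c' z') : Pair n m)‖
      ≤ ℓ * ‖(WithLp.toLp 2 z - WithLp.toLp 2 z' : Pair n m)‖ := by
  refine abs_le_of_sq_le_sq' ?_ (by positivity) |>.2
  rw [mul_pow, ← WithLp.toLp_sub, ← WithLp.toLp_sub, norm_toLp_sq, norm_toLp_sq]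
  have := h.lipschitz z.1 z'.1 z.2 hz z'.2 hz'
  simpa only [meanField, zero_smul, add_zero, Prod.fst_sub, Prod.snd_sub, neg_sub_neg,
    norm_sub_rev (gy z'.1 z'.2)] using this

lemma IsSmoothNCSC.meanField_lipschitz (h : IsSmoothNCSC Y f gx gy ℓ μy L) (hℓ : 0 ≤ ℓ)
    (hγ : 0 ≤ γ) (c : Vec n) {z z' : Vec n × Vec m} (hz : z.2 ∈ Y) (hz' : z'.2 ∈ Y) :
    ‖(WithLp.toLp 2 (meanField gx gy γ c z) - WithLp.toLp 2 (meanField gx gy γ c z') : Pair n m)‖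
      ≤ (ℓ + γ) * ‖(WithLp.toLp 2 z - WithLp.toLp 2 z' : Pair n m)‖ := by
  have e : (WithLp.toLp 2 (meanField gx gy γ c z) - WithLp.toLp 2 (meanField gx gy γ c z') :
      Pair n m) = (WithLp.toLp 2 (meanField gx gy 0 c z) - WithLp.toLp 2 (meanField gx gy 0 c z'))
        + γ • WithLp.toLp 2 (z.1 - z'.1, 0) := by
    rw [← WithLp.toLp_sub, ← WithLp.toLp_sub, ← WithLp.toLp_smul, ← WithLp.toLp_add]
    congr 1
    ext1
    · simp only [meanField, Prod.fst_add, Prod.fst_sub, Prod.smul_fst]; module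
    · simp [meanField]
  have h1 : ‖(WithLp.toLp 2 (z.1 - z'.1, 0) : Pair n m)‖
      ≤ ‖(WithLp.toLp 2 z - WithLp.toLp 2 z' : Pair n m)‖ := by
    refine abs_le_of_sq_le_sq' ?_ (norm_nonneg _) |>.2
    have e2 : ‖(WithLp.toLp 2 z - WithLp.toLp 2 z' : Pair n m)‖ ^ 2
        = ‖z.1 - z'.1‖ ^ 2 + ‖z.2 - z'.2‖ ^ 2 := norm_toLp_sq (z - z')
    rw [e2, norm_toLp_sq]
    simp only [norm_zero]
    nlinarith [sq_nonneg ‖z.2 - z'.2‖]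
  rw [e, add_mul]
  refine (norm_add_le _ _).trans (add_le_add (h.meanField_zero_lipschitz hℓ c c hz hz') ?_)
  rw [norm_smul, Real.norm_of_nonneg hγ]
  exact mul_le_mul_of_nonneg_left h1 hγ

/-- The regularized gap function at an average of feasible points is bounded by the linearized
regret of these points. -/
lemma IsSmoothNCSC.regularized_sub_le_regret (h : IsSmoothNCSC Y f gx gy ℓ μy L) (hμy : 0 ≤ μy)
    (hw : WeaklyConvexX Y f gx ρ) (hργ : ρ ≤ γ) (c : Vec n) {T : ℕ} (hT : 0 < T)
    {z : ℕ → Vec n × Vec m} (hz : ∀ t, (z t).2 ∈ Y) {zbar : Vec n × Vec m}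
    (hbar : zbar = (T : ℝ)⁻¹ • ∑ t ∈ Finset.range T, z t) {p : Vec n × Vec m} (hp : p.2 ∈ Y) :
    zbar.2 ∈ Y ∧ T * (regularized f γ c zbar.1 p.2 - regularized f γ c p.1 zbar.2)
      ≤ ∑ t ∈ Finset.range T, ⟪(WithLp.toLp 2 (meanField gx gy γ c (z t)) : Pair n m),
          WithLp.toLp 2 (z t) - WithLp.toLp 2 p⟫ := by
  have hT0 : (T : ℝ) ≠ 0 := by positivity
  have h1 : zbar.1 = (T : ℝ)⁻¹ • ∑ t ∈ Finset.range T, (z t).1 := by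
    rw [hbar, Prod.smul_fst, Prod.fst_sum]
  have h2 : zbar.2 = (T : ℝ)⁻¹ • ∑ t ∈ Finset.range T, (z t).2 := by
    rw [hbar, Prod.smul_snd, Prod.snd_sum]
  have hbarY : zbar.2 ∈ Y := by
    rw [h2, Finset.smul_sum]
    exact h.convex.sum_mem (fun _ _ => by positivity) (by simp [hT0]) (fun t _ => hz t)
  refine ⟨hbarY, ?_⟩
  -- Both Jensen inequalities below come from the first order inequality at the average, whose
  -- linear terms sum to zero.
  have hs1 : ∑ t ∈ Finset.range T, ((z t).1 - zbar.1) = 0 := by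
    rw [Finset.sum_sub_distrib, h1, Finset.sum_const, Finset.card_range, ← Nat.cast_smul_eq_nsmul ℝ,
      smul_smul, mul_inv_cancel₀ hT0, one_smul, sub_self]
  have hs2 : ∑ t ∈ Finset.range T, ((z t).2 - zbar.2) = 0 := by
    rw [Finset.sum_sub_distrib, h2, Finset.sum_const, Finset.card_range, ← Nat.cast_smul_eq_nsmul ℝ,
      smul_smul, mul_inv_cancel₀ hT0, one_smul, sub_self]
  have hreg : ∀ x x' : Vec n, ∀ y ∈ Y, regularized f γ c x' y
      + ⟪gx x' y + γ • (x' - c), x - x'⟫ ≤ regularized f γ c x y := fun x x' y hy => by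
    have h3 := hw.regularized_ge (γ := γ) c x x' hy
    have h4 : 0 ≤ (γ - ρ) / 2 * ‖x - x'‖ ^ 2 :=
      mul_nonneg (by linarith [sub_nonneg.2 hργ]) (sq_nonneg _)
    linarith
  have hJ1 : T * regularized f γ c zbar.1 p.2
      ≤ ∑ t ∈ Finset.range T, regularized f γ c (z t).1 p.2 := by
    have := Finset.sum_le_sum fun t (_ : t ∈ Finset.range T) => hreg (z t).1 zbar.1 p.2 hp
    rw [Finset.sum_add_distrib, ← inner_sum, hs1, inner_zero_right, Finset.sum_const,
      Finset.card_range, nsmul_eq_mul] at this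
    linarith
  have hJ2 : ∑ t ∈ Finset.range T, regularized f γ c p.1 (z t).2
      ≤ T * regularized f γ c p.1 zbar.2 := by
    have := Finset.sum_le_sum fun t (_ : t ∈ Finset.range T) =>
      h.le_add_inner_gradY hμy p.1 hbarY (hz t)
    rw [Finset.sum_add_distrib, ← inner_sum, hs2, inner_zero_right, Finset.sum_const,
      Finset.card_range, nsmul_eq_mul] at this
    simp only [regularized, Finset.sum_add_distrib, Finset.sum_const, Finset.card_range,
      nsmul_eq_mul]
    linarith
  have hstep : ∀ t, regularized f γ c (z t).1 p.2 - regularized f γ c p.1 (z t).2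
      ≤ ⟪(WithLp.toLp 2 (meanField gx gy γ c (z t)) : Pair n m),
          WithLp.toLp 2 (z t) - WithLp.toLp 2 p⟫ := fun t => by
    have h3 := hreg p.1 (z t).1 (z t).2 (hz t)
    have h4 := h.le_add_inner_gradY hμy (z t).1 (hz t) hp
    rw [← WithLp.toLp_sub, inner_toLp]
    simp only [meanField, Prod.fst_sub, Prod.snd_sub]
    rw [← neg_sub p.1, inner_neg_right, ← neg_sub p.2, inner_neg_neg]
    simp only [regularized] at h3 ⊢
    linarith
  have := Finset.sum_le_sum fun t (_ : t ∈ Finset.range T) => hstep t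
  rw [Finset.sum_sub_distrib] at this
  linarith

variable (Y gx gy Gx Gy γ η) in
/-- The iterate `z_t` of the inner solver on the samples `s`, started at `z₀`. -/
noncomputable def iterate (z₀ : Vec n × Vec m) (s : ℕ → Ξ) (t : ℕ) : Vec n × Vec m :=
  (ogda Y (fun t => field Gx Gy γ z₀.1 (s t)) η z₀ t).1

variable (Y gx gy Gx Gy γ η) in
/-- The anchor `z̃_t` of the inner solver. -/
noncomputable def anchor (z₀ : Vec n × Vec m) (s : ℕ → Ξ) (t : ℕ) : Vec n × Vec m :=
  (ogda Y (fun t => field Gx Gy γ z₀.1 (s t)) η z₀ t).2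

lemma iterate_succ (z₀ : Vec n × Vec m) (s : ℕ → Ξ) (t : ℕ) :
    iterate Y Gx Gy γ η z₀ s (t + 1) = prox Y (anchor Y Gx Gy γ η z₀ s t)
      (η • field Gx Gy γ z₀.1 (s t) (iterate Y Gx Gy γ η z₀ s t)) := rfl

lemma anchor_succ (z₀ : Vec n × Vec m) (s : ℕ → Ξ) (t : ℕ) :
    anchor Y Gx Gy γ η z₀ s (t + 1) = prox Y (anchor Y Gx Gy γ η z₀ s t)
      (η • field Gx Gy γ z₀.1 (s (t + 1)) (iterate Y Gx Gy γ η z₀ s (t + 1))) := rfl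

variable (Y gx gy Gx Gy γ η) in
/-- The anchor that a noiseless step would give instead of the anchor `t + 1`. -/
noncomputable def noiselessAnchor (z₀ : Vec n × Vec m) (s : ℕ → Ξ) (t : ℕ) : Vec n × Vec m :=
  prox Y (anchor Y Gx Gy γ η z₀ s t)
    (η • meanField gx gy γ z₀.1 (iterate Y Gx Gy γ η z₀ s (t + 1)))

variable (Y gx gy Gx Gy γ η) in
/-- The noise of the `t`-th stochastic gradient. -/
noncomputable def iterateNoise (z₀ : Vec n × Vec m) (s : ℕ → Ξ) (t : ℕ) : Pair n m :=
  gradNoise gx gy Gx Gy (iterate Y Gx Gy γ η z₀ s t) (s t)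

variable (Y gx gy Gx Gy γ η) in
/-- The vector against which the noise of step `t + 1` is tested. -/
noncomputable def testVector (z₀ : Vec n × Vec m) (s : ℕ → Ξ) (t : ℕ) : Pair n m :=
  (17 / 10 : ℝ) • (WithLp.toLp 2 (iterate Y Gx Gy γ η z₀ s (t + 1))
      - WithLp.toLp 2 (noiselessAnchor Y gx gy Gx Gy γ η z₀ s t))
    - (WithLp.toLp 2 (iterate Y Gx Gy γ η z₀ s (t + 1))
      - ghost η (iterateNoise Y gx gy Gx Gy γ η z₀ s) (WithLp.toLp 2 z₀) t)

variable (Y gx gy Gx Gy γ η) in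
/-- The total effect of the noise on the output of the inner solver. -/
noncomputable def epochNoise (T : ℕ) (z₀ : Vec n × Vec m) (s : ℕ → Ξ) : ℝ :=
  (η * T)⁻¹ * ∑ t ∈ Finset.range T,
    (η ^ 2 * (9 / 5 * ‖iterateNoise Y gx gy Gx Gy γ η z₀ s (t + 1)‖ ^ 2
        + 23 / 5 * ‖iterateNoise Y gx gy Gx Gy γ η z₀ s t‖ ^ 2)
      + η * ⟪iterateNoise Y gx gy Gx Gy γ η z₀ s (t + 1),
          testVector Y gx gy Gx Gy γ η z₀ s t⟫)

lemma iterate_mem (hY : IsClosed Y) (hc : Convex ℝ Y) {z₀ : Vec n × Vec m} (hz₀ : z₀.2 ∈ Y)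
    (s : ℕ → Ξ) : ∀ t, (iterate Y Gx Gy γ η z₀ s t).2 ∈ Y
  | 0 => hz₀
  | _ + 1 => prox_mem hY hc ⟨_, hz₀⟩ _ _

lemma ogdaAverage_eq (z₀ : Vec n × Vec m) (s : ℕ → Ξ) (T : ℕ) :
    ogdaAverage Y (fun t => field Gx Gy γ z₀.1 (s t)) η T z₀
      = (T : ℝ)⁻¹ • ∑ t ∈ Finset.range T, iterate Y Gx Gy γ η z₀ s (t + 1) := by
  rw [ogdaAverage, Finset.range_eq_Ico, Finset.sum_Ico_add' (fun t => iterate Y Gx Gy γ η z₀ s t)]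
  rfl

/-- Pathwise guarantee of the inner solver. -/
theorem IsSmoothNCSC.ogdaAverage_spec (h : IsSmoothNCSC Y f gx gy ℓ μy L) (hμy : 0 ≤ μy)
    (hw : WeaklyConvexX Y f gx ρ) (hργ : ρ ≤ γ) (hγ : 0 ≤ γ) (hℓ : 0 ≤ ℓ) (hη : 0 < η)
    (hηℓ : (η * (ℓ + γ)) ^ 2 ≤ 25 / 128) {T : ℕ} (hT : 0 < T) {z₀ z : Vec n × Vec m}
    (hz₀ : z₀.2 ∈ Y) (s : ℕ → Ξ)
    (hz : z = ogdaAverage Y (fun t => field Gx Gy γ z₀.1 (s t)) η T z₀) :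
    z.2 ∈ Y ∧ ∀ x, ∀ y ∈ Y, regularized f γ z₀.1 z.1 y - regularized f γ z₀.1 x z.2
      ≤ 3 / (η * T) * (‖x - z₀.1‖ ^ 2 + ‖y - z₀.2‖ ^ 2)
        + epochNoise Y gx gy Gx Gy γ η T z₀ s := by
  have hne : Y.Nonempty := ⟨_, hz₀⟩
  have hmem := iterate_mem (Gx := Gx) (Gy := Gy) (γ := γ) (η := η) h.isClosed h.convex hz₀ s
  have hzbar := hz.trans (ogdaAverage_eq z₀ s T)
  have hreg := fun p hp => h.regularized_sub_le_regret hμy hw hργ z₀.1 hT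
    (fun t => hmem (t + 1)) hzbar (p := p) hp
  refine ⟨(hreg z₀ hz₀).1, fun x y hy => ?_⟩
  have h1 := (hreg (x, y) hy).2
  have hprox := fun c g => isProxPoint_prox (n := n) h.isClosed h.convex hne c g
  have h2 := optimisticGradient_regret (S := feasible n Y) (η := η) (Λ := ℓ + γ)
    (z := fun t => WithLp.toLp 2 (iterate Y Gx Gy γ η z₀ s t))
    (zt := fun t => WithLp.toLp 2 (anchor Y Gx Gy γ η z₀ s t))
    (zn := fun t => WithLp.toLp 2 (noiselessAnchor Y gx gy Gx Gy γ η z₀ s t))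
    (F := fun t => WithLp.toLp 2 (meanField gx gy γ z₀.1 (iterate Y Gx Gy γ η z₀ s t)))
    (θ := iterateNoise Y gx gy Gx Gy γ η z₀ s) hη hηℓ rfl
    (fun t => by
      have := hprox (anchor Y Gx Gy γ η z₀ s t)
        (η • field Gx Gy γ z₀.1 (s t) (iterate Y Gx Gy γ η z₀ s t))
      rwa [WithLp.toLp_smul, toLp_field (gx := gx) (gy := gy)] at this)
    (fun t => by
      have := hprox (anchor Y Gx Gy γ η z₀ s t)
        (η • field Gx Gy γ z₀.1 (s (t + 1)) (iterate Y Gx Gy γ η z₀ s (t + 1)))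
      rwa [WithLp.toLp_smul, toLp_field (gx := gx) (gy := gy)] at this)
    (fun t => by
      have := hprox (anchor Y Gx Gy γ η z₀ s t)
        (η • meanField gx gy γ z₀.1 (iterate Y Gx Gy γ η z₀ s (t + 1)))
      rwa [WithLp.toLp_smul] at this)
    (fun t => h.meanField_lipschitz hℓ hγ z₀.1 (hmem (t + 1)) (hmem t))
    (p := WithLp.toLp 2 (x, y)) hy T
  have hT' : (0 : ℝ) < T := by exact_mod_cast hT
  have hpos : 0 < η * T := by positivity
  have h3 : ‖(WithLp.toLp 2 (iterate Y Gx Gy γ η z₀ s 0) - WithLp.toLp 2 (x, y) : Pair n m)‖ ^ 2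
      = ‖x - z₀.1‖ ^ 2 + ‖y - z₀.2‖ ^ 2 := by
    rw [norm_sub_rev, ← WithLp.toLp_sub, norm_toLp_sq]
    rfl
  rw [h3] at h2
  have h4 := mul_le_mul_of_nonneg_left h1 hη.le
  have h5 := h4.trans h2
  rw [← mul_le_mul_iff_of_pos_left hpos, mul_add, epochNoise, mul_inv_cancel_left₀ hpos.ne']
  have e : η * T * (3 / (η * T) * (‖x - z₀.1‖ ^ 2 + ‖y - z₀.2‖ ^ 2))
      = 3 * (‖x - z₀.1‖ ^ 2 + ‖y - z₀.2‖ ^ 2) := by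
    field_simp
  rw [e, mul_assoc]
  exact h5

end Epoch

/-! ### Moments of noise that is independent of the past. -/

section Noise

variable {Ω A Ξ E : Type*} [MeasurableSpace Ω] [MeasurableSpace A] [MeasurableSpace Ξ]
  [NormedAddCommGroup E] {Pr : Measure Ω} [IsProbabilityMeasure Pr]
  {Z : Ω → A} {X : Ω → Ξ} {H : A × Ξ → E} {C : ℝ}

/-- Square integrability passes through Lipschitz maps; this propagates second moments along the
algorithm. -/
lemma memLp_of_norm_sub_le {E' : Type*} [NormedAddCommGroup E'] {u : Ω → E'} {v : Ω → E} {a : E'}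
    {K : ℝ} (hu : AEStronglyMeasurable u Pr) (hv : MemLp v 2 Pr)
    (h : ∀ ω, ‖u ω - a‖ ≤ K * ‖v ω‖) : MemLp u 2 Pr := by
  have h1 : MemLp (fun ω => ‖a‖ + K * ‖v ω‖) 2 Pr := (memLp_const ‖a‖).add (hv.norm.const_mul K)
  refine h1.of_le hu (Filter.Eventually.of_forall fun ω => ?_)
  refine le_trans ?_ (le_abs_self _)
  linarith [h ω, norm_le_norm_add_norm_sub' (u ω) a]

variable [MeasurableSpace E] [BorelSpace E] [SecondCountableTopology E]

/-- Second moment of a noise vector whose conditional second moments are bounded. -/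
lemma memLp_noise (hZ : Measurable Z) (hX : Measurable X) (hind : IndepFun Z X Pr)
    (hH : Measurable H) (hL2 : ∀ a, MemLp (fun s => H (a, s)) 2 (Pr.map X))
    (hC : ∀ a, ∫ s, ‖H (a, s)‖ ^ 2 ∂(Pr.map X) ≤ C) :
    MemLp (fun ω => H (Z ω, X ω)) 2 Pr ∧ ∫ ω, ‖H (Z ω, X ω)‖ ^ 2 ∂Pr ≤ C := by
  have : IsProbabilityMeasure (Pr.map X) := Measure.isProbabilityMeasure_map hX.aemeasurable
  have : IsProbabilityMeasure (Pr.map Z) := Measure.isProbabilityMeasure_map hZ.aemeasurable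
  have hmap := (indepFun_iff_map_prod_eq_prod_map_map hZ.aemeasurable hX.aemeasurable).1 hind
  have hZX : Measurable fun ω => (Z ω, X ω) := hZ.prodMk hX
  have hm : Measurable fun q : A × Ξ => ‖H q‖ ^ 2 := hH.norm.pow_const 2
  have hint : Integrable (fun q : A × Ξ => ‖H q‖ ^ 2) ((Pr.map Z).prod (Pr.map X)) := by
    refine (integrable_prod_iff hm.aestronglyMeasurable).2
      ⟨Filter.Eventually.of_forall fun a => (hL2 a).integrable_norm_pow two_ne_zero, ?_⟩
    have hsm : StronglyMeasurable fun a => ∫ s, ‖‖H (a, s)‖ ^ 2‖ ∂(Pr.map X) :=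
      hm.norm.stronglyMeasurable.integral_prod_right'
    refine Integrable.of_bound hsm.aestronglyMeasurable C (Filter.Eventually.of_forall fun a => ?_)
    rw [Real.norm_of_nonneg (integral_nonneg fun _ => norm_nonneg _)]
    simpa only [norm_pow, norm_norm] using hC a
  have hint' : Integrable (fun ω => ‖H (Z ω, X ω)‖ ^ 2) Pr := by
    rw [← hmap] at hint
    exact hint.comp_measurable hZX
  refine ⟨(memLp_two_iff_integrable_sq_norm (hH.comp hZX).aestronglyMeasurable).2 hint', ?_⟩
  have e : ∫ ω, ‖H (Z ω, X ω)‖ ^ 2 ∂Pr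
      = ∫ a, ∫ s, ‖H (a, s)‖ ^ 2 ∂(Pr.map X) ∂(Pr.map Z) := by
    rw [← integral_prod _ hint, ← hmap, integral_map hZX.aemeasurable hm.aestronglyMeasurable]
  rw [e]
  calc ∫ a, ∫ s, ‖H (a, s)‖ ^ 2 ∂(Pr.map X) ∂(Pr.map Z) ≤ ∫ _, C ∂(Pr.map Z) :=
        integral_mono hint.integral_prod_left (integrable_const C) hC
    _ = C := by simp

/-- Conditionally centred noise is orthogonal to vectors determined by the past. -/
lemma integral_inner_noise [InnerProductSpace ℝ E] [CompleteSpace E] (hZ : Measurable Z) (hX : Measurable X) (hind : IndepFun Z X Pr)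
    (hH : Measurable H) (hL2 : ∀ a, MemLp (fun s => H (a, s)) 2 (Pr.map X))
    (hC : ∀ a, ∫ s, ‖H (a, s)‖ ^ 2 ∂(Pr.map X) ≤ C)
    (h0 : ∀ a, ∫ s, H (a, s) ∂(Pr.map X) = 0) {V : A → E} (hV : Measurable V)
    (hVL2 : MemLp (fun ω => V (Z ω)) 2 Pr) :
    Integrable (fun ω => ⟪H (Z ω, X ω), V (Z ω)⟫) Pr ∧
      ∫ ω, ⟪H (Z ω, X ω), V (Z ω)⟫ ∂Pr = 0 := by
  have : IsProbabilityMeasure (Pr.map X) := Measure.isProbabilityMeasure_map hX.aemeasurable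
  have : IsProbabilityMeasure (Pr.map Z) := Measure.isProbabilityMeasure_map hZ.aemeasurable
  have hmap := (indepFun_iff_map_prod_eq_prod_map_map hZ.aemeasurable hX.aemeasurable).1 hind
  have hZX : Measurable fun ω => (Z ω, X ω) := hZ.prodMk hX
  have hm : Measurable fun q : A × Ξ => ⟪H q, V q.1⟫ := hH.inner (hV.comp measurable_fst)
  have hint : Integrable (fun ω => ⟪H (Z ω, X ω), V (Z ω)⟫) Pr := by
    have h1 := (memLp_noise hZ hX hind hH hL2 hC).1.integrable_norm_pow two_ne_zero
    have h2 := hVL2.integrable_norm_pow two_ne_zero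
    refine (h1.add h2).mono' (hm.comp hZX).aestronglyMeasurable
      (Filter.Eventually.of_forall fun ω => ?_)
    have h3 := norm_inner_le_norm (𝕜 := ℝ) (H (Z ω, X ω)) (V (Z ω))
    simp only [Pi.add_apply]
    nlinarith [sq_nonneg (‖H (Z ω, X ω)‖ - ‖V (Z ω)‖), sq_nonneg (‖H (Z ω, X ω)‖),
      sq_nonneg ‖V (Z ω)‖]
  refine ⟨hint, ?_⟩
  have hint' : Integrable (fun q : A × Ξ => ⟪H q, V q.1⟫) ((Pr.map Z).prod (Pr.map X)) := by
    rw [← hmap]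
    exact (integrable_map_measure hm.aestronglyMeasurable hZX.aemeasurable).2 hint
  have e : ∫ ω, ⟪H (Z ω, X ω), V (Z ω)⟫ ∂Pr
      = ∫ a, ∫ s, ⟪H (a, s), V a⟫ ∂(Pr.map X) ∂(Pr.map Z) := by
    rw [← integral_prod _ hint', ← hmap,
      integral_map hZX.aemeasurable hm.aestronglyMeasurable]
  have hz : ∀ a, ∫ s, ⟪H (a, s), V a⟫ ∂(Pr.map X) = 0 := fun a => by
    simp_rw [real_inner_comm (V a)]
    rw [integral_inner ((hL2 a).integrable one_le_two), h0 a, inner_zero_right]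
  simp only [e, hz, integral_zero]

end Noise

/-! ### Measurability of the iterates and moments of the gradient error. -/

section Iterates

variable {n m : ℕ} {Ξ Ω : Type*} [MeasurableSpace Ξ] {Y : Set (Vec m)} {f : Vec n → Vec m → ℝ}
  {gx : Vec n → Vec m → Vec n} {gy : Vec n → Vec m → Vec m} {Gx : Vec n → Vec m → Ξ → Vec n}
  {Gy : Vec n → Vec m → Ξ → Vec m} {ℓ μy L ρ γ η : ℝ}

lemma measurable_field {_ : MeasurableSpace Ω}
    (hGx : Measurable fun p : (Vec n × Vec m) × Ξ => Gx p.1.1 p.1.2 p.2)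
    (hGy : Measurable fun p : (Vec n × Vec m) × Ξ => Gy p.1.1 p.1.2 p.2)
    {c : Ω → Vec n} {s : Ω → Ξ} {z : Ω → Vec n × Vec m} (hc : Measurable c) (hs : Measurable s)
    (hz : Measurable z) : Measurable fun ω => field Gx Gy γ (c ω) (s ω) (z ω) :=
  ((hGx.comp (hz.prodMk hs)).add ((hz.fst.sub hc).const_smul γ)).prodMk
    (hGy.comp (hz.prodMk hs)).neg

lemma measurable_prox {_ : MeasurableSpace Ω} (hY : IsClosed Y) (hc : Convex ℝ Y)
    (hne : Y.Nonempty) {c g : Ω → Vec n × Vec m} (hcm : Measurable c) (hg : Measurable g) :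
    Measurable fun ω => prox Y (c ω) (g ω) := by
  have key : ∀ F : (Vec n × Vec m) × (Vec n × Vec m) → Vec n × Vec m, Measurable F →
      Measurable fun ω => F (c ω, g ω) := fun F hF => hF.comp (hcm.prodMk hg)
  exact key _ (continuous_prox hY hc hne).measurable

/-- The two parts differ by one index: the iterate `t` uses the samples before `t`, whereas for `t >
0` the anchor `t` also uses the sample `t`. -/
lemma measurable_iterate_anchor {_ : MeasurableSpace Ω} (hY : IsClosed Y) (hc : Convex ℝ Y)
    (hne : Y.Nonempty) (hGx : Measurable fun p : (Vec n × Vec m) × Ξ => Gx p.1.1 p.1.2 p.2)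
    (hGy : Measurable fun p : (Vec n × Vec m) × Ξ => Gy p.1.1 p.1.2 p.2)
    {z₀ : Ω → Vec n × Vec m} (hz₀ : Measurable z₀) {s : Ω → ℕ → Ξ} (t : ℕ) :
    ((∀ i < t, Measurable fun ω => s ω i) →
      Measurable fun ω => iterate Y Gx Gy γ η (z₀ ω) (s ω) t) ∧
    ((∀ i ≤ t, Measurable fun ω => s ω i) →
      Measurable fun ω => anchor Y Gx Gy γ η (z₀ ω) (s ω) t) := by
  induction t with
  | zero => exact ⟨fun _ => hz₀, fun _ => hz₀⟩
  | succ t ih =>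
    have h1 : (∀ i < t + 1, Measurable fun ω => s ω i) →
        Measurable fun ω => iterate Y Gx Gy γ η (z₀ ω) (s ω) (t + 1) := fun hs => by
      simp only [iterate_succ]
      exact measurable_prox hY hc hne (ih.2 fun i hi => hs i (by omega))
        ((measurable_field hGx hGy hz₀.fst (hs t (by omega))
          (ih.1 fun i hi => hs i (by omega))).const_smul η)
    refine ⟨h1, fun hs => ?_⟩
    simp only [anchor_succ]
    exact measurable_prox hY hc hne (ih.2 fun i hi => hs i (by omega))
      ((measurable_field hGx hGy hz₀.fst (hs (t + 1) le_rfl)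
        (h1 fun i hi => hs i (by omega))).const_smul η)

/-- Nothing is known about the gradients off `Y`. Measurability comes from Lipschitz continuity on
the subtype `ℝⁿ × Y`, in which the iterates stay. -/
lemma IsSmoothNCSC.measurable_meanField {_ : MeasurableSpace Ω}
    (h : IsSmoothNCSC Y f gx gy ℓ μy L) (hℓ : 0 ≤ ℓ) {c : Ω → Vec n} {z : Ω → Vec n × Vec m}
    (hc : Measurable c) (hz : Measurable z) (hmem : ∀ ω, (z ω).2 ∈ Y) :
    Measurable fun ω => meanField gx gy γ (c ω) (z ω) := by
  have hS : IsClosed {z : Vec n × Vec m | z.2 ∈ Y} := h.isClosed.preimage continuous_snd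
  have hcont : Continuous fun z : {z : Vec n × Vec m // z.2 ∈ Y} => meanField gx gy 0 0 z.1 := by
    suffices hlp : Continuous fun z : {z : Vec n × Vec m // z.2 ∈ Y} =>
        (WithLp.toLp 2 (meanField gx gy 0 0 z.1) : Pair n m) from
      (WithLp.prod_continuous_ofLp 2 (Vec n) (Vec m)).comp hlp
    refine continuous_iff_continuousAt.2 fun q => tendsto_iff_norm_sub_tendsto_zero.2 ?_
    have h1 : Continuous fun r : {z : Vec n × Vec m // z.2 ∈ Y} =>
        ℓ * ‖(WithLp.toLp 2 r.1 - WithLp.toLp 2 q.1 : Pair n m)‖ := by fun_prop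
    refine squeeze_zero (fun _ => norm_nonneg _)
      (fun r => h.meanField_zero_lipschitz hℓ 0 0 r.2 q.2) ?_
    simpa using h1.tendsto q
  have h0 : Measurable fun ω => meanField gx gy 0 0 (z ω) :=
    hcont.measurable.comp (hz.subtype_mk (h := hmem))
  have e : (fun ω => meanField gx gy γ (c ω) (z ω))
      = fun ω => meanField gx gy 0 0 (z ω) + (γ • ((z ω).1 - c ω), 0) := by
    funext ω
    ext1 <;> simp [meanField]
  rw [e]
  exact h0.add (((hz.fst.sub hc).const_smul γ).prodMk measurable_const)

lemma IsSmoothNCSC.measurable_gradNoise {_ : MeasurableSpace Ω}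
    (h : IsSmoothNCSC Y f gx gy ℓ μy L) (hℓ : 0 ≤ ℓ)
    (hGx : Measurable fun p : (Vec n × Vec m) × Ξ => Gx p.1.1 p.1.2 p.2)
    (hGy : Measurable fun p : (Vec n × Vec m) × Ξ => Gy p.1.1 p.1.2 p.2)
    {z : Ω → Vec n × Vec m} {s : Ω → Ξ} (hz : Measurable z) (hs : Measurable s)
    (hmem : ∀ ω, (z ω).2 ∈ Y) :
    Measurable fun ω => gradNoise gx gy Gx Gy (z ω) (s ω) := by
  have h1 : Measurable fun ω => field Gx Gy 0 0 (s ω) (z ω) :=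
    measurable_field hGx hGy measurable_const hs hz
  have h2 : Measurable fun ω => meanField gx gy 0 0 (z ω) :=
    h.measurable_meanField hℓ measurable_const hz hmem
  have e : (fun ω => gradNoise gx gy Gx Gy (z ω) (s ω))
      = fun ω => (WithLp.toLp 2 (field Gx Gy 0 0 (s ω) (z ω))
          - WithLp.toLp 2 (meanField gx gy 0 0 (z ω)) : Pair n m) := by
    funext ω
    rw [toLp_field (gx := gx) (gy := gy), add_sub_cancel_left]
  rw [e]
  have h3 := WithLp.measurable_toLp 2 (Vec n × Vec m)
  exact (h3.comp h1).sub (h3.comp h2)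

lemma IsStochasticGradient.gradNoise_spec {σ : ℝ} {ν : Measure Ξ} [IsProbabilityMeasure ν]
    (h : IsStochasticGradient Y gx gy Gx Gy σ ν) {z : Vec n × Vec m} (hz : z.2 ∈ Y) :
    MemLp (fun s => gradNoise gx gy Gx Gy z s) 2 ν ∧
      ∫ s, gradNoise gx gy Gx Gy z s ∂ν = 0 ∧
      ∫ s, ‖gradNoise gx gy Gx Gy z s‖ ^ 2 ∂ν ≤ 2 * σ ^ 2 := by
  have hx : MemLp (fun s => Gx z.1 z.2 s - gx z.1 z.2) 2 ν :=
    (h.memLpX z.1 z.2 hz).sub (memLp_const _)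
  have hy : MemLp (fun s => gy z.1 z.2 - Gy z.1 z.2 s) 2 ν :=
    (memLp_const _).sub (h.memLpY z.1 z.2 hz)
  have e : ∀ s, ‖gradNoise gx gy Gx Gy z s‖ ^ 2
      = ‖Gx z.1 z.2 s - gx z.1 z.2‖ ^ 2 + ‖Gy z.1 z.2 s - gy z.1 z.2‖ ^ 2 := fun s => by
    rw [gradNoise, norm_toLp_sq, norm_sub_rev (gy z.1 z.2)]
  have hyn : Integrable (fun s => ‖Gy z.1 z.2 s - gy z.1 z.2‖ ^ 2) ν := by
    simpa only [norm_sub_rev (gy z.1 z.2)] using hy.integrable_norm_pow two_ne_zero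
  have hxn := hx.integrable_norm_pow two_ne_zero
  have hpair : Integrable (fun s => (Gx z.1 z.2 s - gx z.1 z.2, gy z.1 z.2 - Gy z.1 z.2 s)) ν :=
    (hx.integrable one_le_two).prodMk (hy.integrable one_le_two)
  refine ⟨?_, ?_, ?_⟩
  · refine (memLp_two_iff_integrable_sq_norm ?_).2 ?_
    · exact (WithLp.prod_continuous_toLp 2 (Vec n) (Vec m)).comp_aestronglyMeasurable
        (hx.1.prodMk hy.1)
    · simp only [e]
      exact hxn.add hyn
  · have h1 := (WithLp.prodContinuousLinearEquiv 2 ℝ (Vec n) (Vec m)).symm.integral_comp_comm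
      (μ := ν) (fun s => (Gx z.1 z.2 s - gx z.1 z.2, gy z.1 z.2 - Gy z.1 z.2 s))
    have h2 := integral_pair (hx.integrable one_le_two) (hy.integrable one_le_two)
    rw [integral_sub ((h.memLpX z.1 z.2 hz).integrable one_le_two) (integrable_const _),
      integral_sub (integrable_const _) ((h.memLpY z.1 z.2 hz).integrable one_le_two),
      h.unbiasedX z.1 z.2 hz, h.unbiasedY z.1 z.2 hz] at h2
    simp only [integral_const, probReal_univ, one_smul, sub_self] at h2
    rw [h2] at h1
    exact h1.trans (map_zero _)
  · simp only [e]
    rw [integral_add hxn hyn]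
    linarith [h.varianceX z.1 z.2 hz, h.varianceY z.1 z.2 hz]

end Iterates

/-- One run of the inner solver from a random start `z₀` on the samples `s`, where the sample `t` is
independent of the past `𝓕 t`. -/
structure EpochSetup {n m : ℕ} {Ξ Ω : Type*} [MeasurableSpace Ξ] [MeasurableSpace Ω]
    (Y : Set (Vec m)) (f : Vec n → Vec m → ℝ)
    (gx : Vec n → Vec m → Vec n) (gy : Vec n → Vec m → Vec m) (Gx : Vec n → Vec m → Ξ → Vec n)
    (Gy : Vec n → Vec m → Ξ → Vec m) (ℓ μy L σ : ℝ) (Pr : Measure Ω) (z₀ : Ω → Vec n × Vec m)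
    (s : Ω → ℕ → Ξ) (𝓕 : ℕ → MeasurableSpace Ω) : Prop where
  smooth : IsSmoothNCSC Y f gx gy ℓ μy L
  nonneg : 0 ≤ ℓ
  measurableX : Measurable fun p : (Vec n × Vec m) × Ξ => Gx p.1.1 p.1.2 p.2
  measurableY : Measurable fun p : (Vec n × Vec m) × Ξ => Gy p.1.1 p.1.2 p.2
  le : ∀ t, 𝓕 t ≤ ‹MeasurableSpace Ω›
  mono : Monotone 𝓕
  measurable_start : Measurable[𝓕 0] z₀
  memLp_start : MemLp (fun ω => (WithLp.toLp 2 (z₀ ω) : Pair n m)) 2 Pr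
  mem_start : ∀ ω, (z₀ ω).2 ∈ Y
  measurable_sample : ∀ t, Measurable[𝓕 (t + 1)] fun ω => s ω t
  indep : ∀ t, Indep (𝓕 t) (MeasurableSpace.comap (fun ω => s ω t) inferInstance) Pr
  oracle : ∀ t, IsStochasticGradient Y gx gy Gx Gy σ (Pr.map fun ω => s ω t)

/-! ### One epoch from a random start: adaptedness, second moments and mean noise. -/

namespace EpochSetup

variable {n m : ℕ} {Ξ Ω : Type*} [MeasurableSpace Ξ] [MeasurableSpace Ω]
  {Y : Set (Vec m)} {f : Vec n → Vec m → ℝ}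
  {gx : Vec n → Vec m → Vec n} {gy : Vec n → Vec m → Vec m} {Gx : Vec n → Vec m → Ξ → Vec n}
  {Gy : Vec n → Vec m → Ξ → Vec m} {ℓ μy L σ γ η : ℝ} {Pr : Measure Ω}
  {z₀ : Ω → Vec n × Vec m} {s : Ω → ℕ → Ξ} {𝓕 : ℕ → MeasurableSpace Ω}

lemma measurable_sample' (S : EpochSetup Y f gx gy Gx Gy ℓ μy L σ Pr z₀ s 𝓕) (t : ℕ) :
    Measurable fun ω => s ω t :=
  (S.measurable_sample t).mono (S.le _) le_rfl

lemma iterate_mem (S : EpochSetup Y f gx gy Gx Gy ℓ μy L σ Pr z₀ s 𝓕) (t : ℕ) (ω : Ω) :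
    (iterate Y Gx Gy γ η (z₀ ω) (s ω) t).2 ∈ Y :=
  PES.iterate_mem S.smooth.isClosed S.smooth.convex (S.mem_start ω) _ t

variable [IsProbabilityMeasure Pr]

lemma nonempty (S : EpochSetup Y f gx gy Gx Gy ℓ μy L σ Pr z₀ s 𝓕) : Y.Nonempty := by
  obtain ⟨ω⟩ := nonempty_of_isProbabilityMeasure Pr
  exact ⟨_, S.mem_start ω⟩

/-- Moments of the gradient error at a point determined by the past. -/
lemma gradNoise_spec (S : EpochSetup Y f gx gy Gx Gy ℓ μy L σ Pr z₀ s 𝓕) (t : ℕ)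
    {z : Ω → Vec n × Vec m} (hz : Measurable[𝓕 t] z) (hmem : ∀ ω, (z ω).2 ∈ Y) :
    MemLp (fun ω => gradNoise gx gy Gx Gy (z ω) (s ω t)) 2 Pr ∧
      ∫ ω, ‖gradNoise gx gy Gx Gy (z ω) (s ω t)‖ ^ 2 ∂Pr ≤ 2 * σ ^ 2 ∧
      ∀ V : Ω → Pair n m, Measurable[𝓕 t] V → MemLp V 2 Pr →
        Integrable (fun ω => ⟪gradNoise gx gy Gx Gy (z ω) (s ω t), V ω⟫) Pr ∧
        ∫ ω, ⟪gradNoise gx gy Gx Gy (z ω) (s ω t), V ω⟫ ∂Pr = 0 := by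
  have hX := S.measurable_sample' t
  have : IsProbabilityMeasure (Pr.map fun ω => s ω t) :=
    Measure.isProbabilityMeasure_map hX.aemeasurable
  -- The query point and the test vector form a single variable of the past, so its joint law with
  -- the sample is a product. The subtype is needed because the oracle is only controlled on `Y`.
  have hspec := fun a : {z : Vec n × Vec m // z.2 ∈ Y} × Pair n m =>
    (S.oracle t).gradNoise_spec (z := a.1.1) a.1.2
  have hH : Measurable fun q : ({z : Vec n × Vec m // z.2 ∈ Y} × Pair n m) × Ξ =>
      gradNoise gx gy Gx Gy q.1.1.1 q.2 :=
    S.smooth.measurable_gradNoise S.nonneg S.measurableX S.measurableY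
      (measurable_subtype_coe.comp measurable_fst.fst) measurable_snd fun q => q.1.1.2
  have hZ : ∀ V : Ω → Pair n m, Measurable[𝓕 t] V → Measurable[𝓕 t] fun ω =>
      ((⟨z ω, hmem ω⟩, V ω) : {z : Vec n × Vec m // z.2 ∈ Y} × Pair n m) := fun V hV =>
    (hz.subtype_mk (h := hmem)).prodMk hV
  have hind : ∀ V : Ω → Pair n m, Measurable[𝓕 t] V → IndepFun (fun ω =>
      ((⟨z ω, hmem ω⟩, V ω) : {z : Vec n × Vec m // z.2 ∈ Y} × Pair n m)) (fun ω => s ω t) Pr :=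
    fun V hV => (IndepFun_iff_Indep _ _ _).2
      (indep_of_indep_of_le_left (S.indep t) (hZ V hV).comap_le)
  have h1 := memLp_noise ((hZ 0 measurable_const).mono (S.le t) le_rfl) hX
    (hind 0 measurable_const) hH (fun a => (hspec a).1) (fun a => (hspec a).2.2)
  refine ⟨h1.1, h1.2, fun V hV hVL2 => ?_⟩
  exact integral_inner_noise ((hZ V hV).mono (S.le t) le_rfl) hX (hind V hV) hH
    (fun a => (hspec a).1) (fun a => (hspec a).2.2) (fun a => (hspec a).2.1)
    (V := fun a => a.2) measurable_snd hVL2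

lemma measurable_iterate (S : EpochSetup Y f gx gy Gx Gy ℓ μy L σ Pr z₀ s 𝓕) (t : ℕ) :
    Measurable[𝓕 t] fun ω => iterate Y Gx Gy γ η (z₀ ω) (s ω) t :=
  (measurable_iterate_anchor S.smooth.isClosed S.smooth.convex S.nonempty S.measurableX
    S.measurableY (S.measurable_start.mono (S.mono (Nat.zero_le t)) le_rfl) t).1
    fun i hi => (S.measurable_sample i).mono (S.mono hi) le_rfl

lemma measurable_anchor (S : EpochSetup Y f gx gy Gx Gy ℓ μy L σ Pr z₀ s 𝓕) (t : ℕ) :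
    Measurable[𝓕 (t + 1)] fun ω => anchor Y Gx Gy γ η (z₀ ω) (s ω) t :=
  (measurable_iterate_anchor S.smooth.isClosed S.smooth.convex S.nonempty S.measurableX
    S.measurableY (S.measurable_start.mono (S.mono (Nat.zero_le (t + 1))) le_rfl) t).2
    fun i hi => (S.measurable_sample i).mono (S.mono (Nat.succ_le_succ hi)) le_rfl

lemma measurable_noiselessAnchor (S : EpochSetup Y f gx gy Gx Gy ℓ μy L σ Pr z₀ s 𝓕) (t : ℕ) :
    Measurable[𝓕 (t + 1)] fun ω => noiselessAnchor Y gx gy Gx Gy γ η (z₀ ω) (s ω) t :=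
  measurable_prox S.smooth.isClosed S.smooth.convex S.nonempty (S.measurable_anchor t)
    ((S.smooth.measurable_meanField S.nonneg
      (S.measurable_start.mono (S.mono (Nat.zero_le (t + 1))) le_rfl).fst
      (S.measurable_iterate (t + 1)) (S.iterate_mem (t + 1))).const_smul η)

lemma measurable_iterateNoise (S : EpochSetup Y f gx gy Gx Gy ℓ μy L σ Pr z₀ s 𝓕) (t : ℕ) :
    Measurable[𝓕 (t + 1)] fun ω => iterateNoise Y gx gy Gx Gy γ η (z₀ ω) (s ω) t :=
  S.smooth.measurable_gradNoise S.nonneg S.measurableX S.measurableY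
    ((S.measurable_iterate t).mono (S.mono (Nat.le_succ t)) le_rfl) (S.measurable_sample t)
    (S.iterate_mem t)

lemma memLp_iterateNoise (S : EpochSetup Y f gx gy Gx Gy ℓ μy L σ Pr z₀ s 𝓕) (t : ℕ) :
    MemLp (fun ω => iterateNoise Y gx gy Gx Gy γ η (z₀ ω) (s ω) t) 2 Pr :=
  (S.gradNoise_spec t (S.measurable_iterate t) (S.iterate_mem t)).1

lemma memLp_prox (S : EpochSetup Y f gx gy Gx Gy ℓ μy L σ Pr z₀ s 𝓕)
    {c g : Ω → Vec n × Vec m} (hcm : Measurable c) (hgm : Measurable g)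
    (hc : MemLp (fun ω => (WithLp.toLp 2 (c ω) : Pair n m)) 2 Pr)
    (hg : MemLp (fun ω => (WithLp.toLp 2 (g ω) : Pair n m)) 2 Pr) :
    MemLp (fun ω => (WithLp.toLp 2 (prox Y (c ω) (η • g ω)) : Pair n m)) 2 Pr := by
  have hm := measurable_prox S.smooth.isClosed S.smooth.convex S.nonempty hcm (hgm.const_smul η)
  refine memLp_of_norm_sub_le (a := WithLp.toLp 2 (prox Y 0 0)) (K := 1)
    ((WithLp.measurable_toLp 2 _).comp hm).aestronglyMeasurable (hc.sub (hg.const_smul η))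
    fun ω => ?_
  have := norm_prox_sub_le S.smooth.isClosed S.smooth.convex S.nonempty (c ω) (η • g ω) 0 0
  rw [sub_zero, WithLp.toLp_zero, sub_zero, WithLp.toLp_sub, WithLp.toLp_smul] at this
  rw [one_mul]
  exact this

/-- At `z = z₀` the regularization vanishes and the unregularized field has linear growth; the
Lipschitz bound with the same centre then covers every other point. -/
lemma memLp_meanField (S : EpochSetup Y f gx gy Gx Gy ℓ μy L σ Pr z₀ s 𝓕) (hγ : 0 ≤ γ)
    {z : Ω → Vec n × Vec m} (hz : Measurable z) (hmem : ∀ ω, (z ω).2 ∈ Y)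
    (hL2 : MemLp (fun ω => (WithLp.toLp 2 (z ω) : Pair n m)) 2 Pr) :
    MemLp (fun ω => (WithLp.toLp 2 (meanField gx gy γ (z₀ ω).1 (z ω)) : Pair n m)) 2 Pr := by
  have hlp := WithLp.measurable_toLp 2 (Vec n × Vec m)
  have hz₀ : Measurable z₀ := S.measurable_start.mono (S.le 0) le_rfl
  have hm := S.smooth.measurable_meanField (γ := γ) S.nonneg hz₀.fst hz hmem
  have hm₀ := S.smooth.measurable_meanField (γ := γ) S.nonneg hz₀.fst hz₀ S.mem_start
  obtain ⟨y, hy⟩ := S.nonempty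
  have h1 : MemLp (fun ω => (WithLp.toLp 2 (meanField gx gy γ (z₀ ω).1 (z₀ ω)) : Pair n m)) 2 Pr := by
    refine memLp_of_norm_sub_le (a := WithLp.toLp 2 (meanField gx gy 0 0 (0, y))) (K := ℓ)
      (hlp.comp hm₀).aestronglyMeasurable (S.memLp_start.sub (memLp_const (WithLp.toLp 2 (0, y))))
      fun ω => ?_
    have e : meanField gx gy γ (z₀ ω).1 (z₀ ω) = meanField gx gy 0 0 (z₀ ω) := by
      simp [meanField]
    rw [e]
    exact S.smooth.meanField_zero_lipschitz S.nonneg 0 0 (S.mem_start ω) hy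
  have h2 : MemLp (fun ω => (WithLp.toLp 2 (meanField gx gy γ (z₀ ω).1 (z ω))
      - WithLp.toLp 2 (meanField gx gy γ (z₀ ω).1 (z₀ ω)) : Pair n m)) 2 Pr := by
    refine memLp_of_norm_sub_le (a := 0) (K := ℓ + γ)
      ((hlp.comp hm).sub (hlp.comp hm₀)).aestronglyMeasurable (hL2.sub S.memLp_start) fun ω => ?_
    rw [sub_zero]
    exact S.smooth.meanField_lipschitz S.nonneg hγ _ (hmem ω) (S.mem_start ω)
  refine (h2.add h1).congr_norm (hlp.comp hm).aestronglyMeasurable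
    (Filter.Eventually.of_forall fun ω => ?_)
  simp only [Pi.add_apply, sub_add_cancel]

lemma memLp_field (S : EpochSetup Y f gx gy Gx Gy ℓ μy L σ Pr z₀ s 𝓕) (hγ : 0 ≤ γ) (t : ℕ)
    (h : MemLp (fun ω => (WithLp.toLp 2 (iterate Y Gx Gy γ η (z₀ ω) (s ω) t) : Pair n m)) 2 Pr) :
    MemLp (fun ω => (WithLp.toLp 2 (field Gx Gy γ (z₀ ω).1 (s ω t)
      (iterate Y Gx Gy γ η (z₀ ω) (s ω) t)) : Pair n m)) 2 Pr := by
  simp only [toLp_field (gx := gx) (gy := gy)]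
  exact (S.memLp_meanField hγ ((S.measurable_iterate t).mono (S.le t) le_rfl) (S.iterate_mem t)
    h).add (S.memLp_iterateNoise t)

lemma memLp_iterate_anchor (S : EpochSetup Y f gx gy Gx Gy ℓ μy L σ Pr z₀ s 𝓕) (hγ : 0 ≤ γ)
    (t : ℕ) :
    MemLp (fun ω => (WithLp.toLp 2 (iterate Y Gx Gy γ η (z₀ ω) (s ω) t) : Pair n m)) 2 Pr ∧
    MemLp (fun ω => (WithLp.toLp 2 (anchor Y Gx Gy γ η (z₀ ω) (s ω) t) : Pair n m)) 2 Pr := by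
  have hz₀ : Measurable z₀ := S.measurable_start.mono (S.le 0) le_rfl
  have hfield : ∀ t, Measurable fun ω => field Gx Gy γ (z₀ ω).1 (s ω t)
      (iterate Y Gx Gy γ η (z₀ ω) (s ω) t) := fun t =>
    measurable_field S.measurableX S.measurableY hz₀.fst (S.measurable_sample' t)
      ((S.measurable_iterate t).mono (S.le t) le_rfl)
  induction t with
  | zero => exact ⟨S.memLp_start, S.memLp_start⟩
  | succ t ih =>
    have ha : Measurable fun ω => anchor Y Gx Gy γ η (z₀ ω) (s ω) t :=
      (S.measurable_anchor t).mono (S.le _) le_rfl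
    have h1 : MemLp (fun ω => (WithLp.toLp 2 (iterate Y Gx Gy γ η (z₀ ω) (s ω) (t + 1)) :
        Pair n m)) 2 Pr := by
      simp only [iterate_succ]
      exact S.memLp_prox ha (hfield t) ih.2 (S.memLp_field hγ t ih.1)
    refine ⟨h1, ?_⟩
    simp only [anchor_succ]
    exact S.memLp_prox ha (hfield (t + 1)) ih.2 (S.memLp_field hγ (t + 1) h1)

lemma memLp_noiselessAnchor (S : EpochSetup Y f gx gy Gx Gy ℓ μy L σ Pr z₀ s 𝓕) (hγ : 0 ≤ γ)
    (t : ℕ) : MemLp (fun ω => (WithLp.toLp 2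
      (noiselessAnchor Y gx gy Gx Gy γ η (z₀ ω) (s ω) t) : Pair n m)) 2 Pr := by
  have hz : Measurable fun ω => iterate Y Gx Gy γ η (z₀ ω) (s ω) (t + 1) :=
    (S.measurable_iterate (t + 1)).mono (S.le _) le_rfl
  have ha : Measurable fun ω => anchor Y Gx Gy γ η (z₀ ω) (s ω) t :=
    (S.measurable_anchor t).mono (S.le _) le_rfl
  have hF := S.smooth.measurable_meanField (γ := γ) S.nonneg
    (S.measurable_start.mono (S.le 0) le_rfl).fst hz (S.iterate_mem (t + 1))
  have hFL2 := S.memLp_meanField hγ hz (S.iterate_mem (t + 1))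
    (S.memLp_iterate_anchor hγ (t + 1)).1
  exact S.memLp_prox ha hF (S.memLp_iterate_anchor hγ t).2 hFL2

/-- The test vector for the noise of step `t + 1` involves only the samples `0, …, t`: this is what
makes their inner product centred. -/
lemma testVector_spec (S : EpochSetup Y f gx gy Gx Gy ℓ μy L σ Pr z₀ s 𝓕) (hγ : 0 ≤ γ) (t : ℕ) :
    Measurable[𝓕 (t + 1)] (fun ω => testVector Y gx gy Gx Gy γ η (z₀ ω) (s ω) t) ∧
    MemLp (fun ω => testVector Y gx gy Gx Gy γ η (z₀ ω) (s ω) t) 2 Pr := by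
  have hlp := WithLp.measurable_toLp 2 (Vec n × Vec m)
  have hz := S.measurable_iterate (γ := γ) (η := η) (t + 1)
  have hn := S.measurable_noiselessAnchor (γ := γ) (η := η) t
  have hzL2 := (S.memLp_iterate_anchor (η := η) hγ (t + 1)).1
  have hnL2 := S.memLp_noiselessAnchor (η := η) hγ t
  have hg : Measurable[𝓕 (t + 1)] fun ω => ghost η (iterateNoise Y gx gy Gx Gy γ η (z₀ ω) (s ω))
      (WithLp.toLp 2 (z₀ ω) : Pair n m) t := by
    refine (hlp.comp (S.measurable_start.mono (S.mono (Nat.zero_le _)) le_rfl)).add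
      (Measurable.const_smul (Finset.measurable_fun_sum _ fun i hi => ?_) (η / 5))
    exact (S.measurable_iterateNoise (i + 1)).mono
      (S.mono (by have := Finset.mem_range.1 hi; omega)) le_rfl
  have hgL2 : MemLp (fun ω => ghost η (iterateNoise Y gx gy Gx Gy γ η (z₀ ω) (s ω))
      (WithLp.toLp 2 (z₀ ω) : Pair n m) t) 2 Pr :=
    S.memLp_start.add ((memLp_finsetSum (Finset.range t) fun i _ =>
      S.memLp_iterateNoise (γ := γ) (η := η) (i + 1)).const_smul (η / 5))
  have hz' := hlp.comp hz
  have hn' := hlp.comp hn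
  simp only [testVector]
  constructor
  · exact ((hz'.sub hn').const_smul (17 / 10 : ℝ)).sub (hz'.sub hg)
  · exact ((hzL2.sub hnL2).const_smul (17 / 10 : ℝ)).sub (hzL2.sub hgL2)

/-- The noise of a run is integrable, with small mean. -/
theorem epochNoise_spec (S : EpochSetup Y f gx gy Gx Gy ℓ μy L σ Pr z₀ s 𝓕) (hγ : 0 ≤ γ)
    (hη : 0 < η) {T : ℕ} (hT : 0 < T) :
    Integrable (fun ω => epochNoise Y gx gy Gx Gy γ η T (z₀ ω) (s ω)) Pr ∧
      ∫ ω, epochNoise Y gx gy Gx Gy γ η T (z₀ ω) (s ω) ∂Pr ≤ 64 / 5 * η * σ ^ 2 := by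
  have hN : ∀ t, Integrable (fun ω => ‖iterateNoise Y gx gy Gx Gy γ η (z₀ ω) (s ω) t‖ ^ 2) Pr :=
    fun t => (S.memLp_iterateNoise t).integrable_norm_pow two_ne_zero
  have hN' : ∀ t, ∫ ω, ‖iterateNoise Y gx gy Gx Gy γ η (z₀ ω) (s ω) t‖ ^ 2 ∂Pr ≤ 2 * σ ^ 2 :=
    fun t => (S.gradNoise_spec t (S.measurable_iterate t) (S.iterate_mem t)).2.1
  have hI : ∀ t, Integrable (fun ω => ⟪iterateNoise Y gx gy Gx Gy γ η (z₀ ω) (s ω) (t + 1),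
      testVector Y gx gy Gx Gy γ η (z₀ ω) (s ω) t⟫) Pr ∧
      ∫ ω, ⟪iterateNoise Y gx gy Gx Gy γ η (z₀ ω) (s ω) (t + 1),
        testVector Y gx gy Gx Gy γ η (z₀ ω) (s ω) t⟫ ∂Pr = 0 := fun t =>
    (S.gradNoise_spec (t + 1) (S.measurable_iterate (t + 1)) (S.iterate_mem (t + 1))).2.2 _
      (S.testVector_spec hγ t).1 (S.testVector_spec hγ t).2
  have hQ : ∀ t, Integrable (fun ω =>
      η ^ 2 * (9 / 5 * ‖iterateNoise Y gx gy Gx Gy γ η (z₀ ω) (s ω) (t + 1)‖ ^ 2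
        + 23 / 5 * ‖iterateNoise Y gx gy Gx Gy γ η (z₀ ω) (s ω) t‖ ^ 2)) Pr := fun t =>
    (((hN (t + 1)).const_mul _).add ((hN t).const_mul _)).const_mul _
  have hstep : ∀ t, Integrable (fun ω =>
      η ^ 2 * (9 / 5 * ‖iterateNoise Y gx gy Gx Gy γ η (z₀ ω) (s ω) (t + 1)‖ ^ 2
        + 23 / 5 * ‖iterateNoise Y gx gy Gx Gy γ η (z₀ ω) (s ω) t‖ ^ 2)
      + η * ⟪iterateNoise Y gx gy Gx Gy γ η (z₀ ω) (s ω) (t + 1),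
          testVector Y gx gy Gx Gy γ η (z₀ ω) (s ω) t⟫) Pr := fun t =>
    (hQ t).add ((hI t).1.const_mul _)
  refine ⟨(integrable_finsetSum _ fun t _ => hstep t).const_mul _, ?_⟩
  have hval : ∀ t, ∫ ω, (η ^ 2 * (9 / 5 * ‖iterateNoise Y gx gy Gx Gy γ η (z₀ ω) (s ω) (t + 1)‖ ^ 2
        + 23 / 5 * ‖iterateNoise Y gx gy Gx Gy γ η (z₀ ω) (s ω) t‖ ^ 2)
      + η * ⟪iterateNoise Y gx gy Gx Gy γ η (z₀ ω) (s ω) (t + 1),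
          testVector Y gx gy Gx Gy γ η (z₀ ω) (s ω) t⟫) ∂Pr ≤ η ^ 2 * (64 / 5 * σ ^ 2) := fun t => by
    rw [integral_add (hQ t) ((hI t).1.const_mul _), integral_const_mul, integral_const_mul,
      integral_add ((hN (t + 1)).const_mul _) ((hN t).const_mul _), integral_const_mul,
      integral_const_mul, (hI t).2, mul_zero, add_zero]
    -- Both blocks contribute `σ²`, so the constant is `2 (9/5 + 23/5) = 64/5`.
    exact mul_le_mul_of_nonneg_left (by linarith [hN' t, hN' (t + 1)]) (sq_nonneg η)
  have hT' : (0 : ℝ) < T := by exact_mod_cast hT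
  simp only [epochNoise]
  rw [integral_const_mul, integral_finsetSum _ fun t _ => hstep t]
  calc (η * T)⁻¹ * ∑ t ∈ Finset.range T, _
      ≤ (η * T)⁻¹ * ∑ t ∈ Finset.range T, η ^ 2 * (64 / 5 * σ ^ 2) :=
        mul_le_mul_of_nonneg_left (Finset.sum_le_sum fun t _ => hval t) (by positivity)
    _ = 64 / 5 * η * σ ^ 2 := by
        rw [Finset.sum_const, Finset.card_range, nsmul_eq_mul]
        field_simp

lemma memLp_ogdaAverage (S : EpochSetup Y f gx gy Gx Gy ℓ μy L σ Pr z₀ s 𝓕) (hγ : 0 ≤ γ)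
    (T : ℕ) : MemLp (fun ω => (WithLp.toLp 2 (ogdaAverage Y
      (fun t => field Gx Gy γ (z₀ ω).1 (s ω t)) η T (z₀ ω)) : Pair n m)) 2 Pr := by
  simp only [ogdaAverage_eq, WithLp.toLp_smul, WithLp.toLp_sum]
  exact (memLp_finsetSum (Finset.range T) fun t _ =>
    (S.memLp_iterate_anchor (η := η) hγ (t + 1)).1).const_smul (T : ℝ)⁻¹

end EpochSetup

lemma measurable_ogdaAverage {n m : ℕ} {Ξ Ω : Type*} [MeasurableSpace Ξ] {Y : Set (Vec m)}
    {Gx : Vec n → Vec m → Ξ → Vec n} {Gy : Vec n → Vec m → Ξ → Vec m} {γ η : ℝ}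
    {_ : MeasurableSpace Ω} (hY : IsClosed Y) (hc : Convex ℝ Y)
    (hne : Y.Nonempty) (hGx : Measurable fun p : (Vec n × Vec m) × Ξ => Gx p.1.1 p.1.2 p.2)
    (hGy : Measurable fun p : (Vec n × Vec m) × Ξ => Gy p.1.1 p.1.2 p.2)
    {z₀ : Ω → Vec n × Vec m} (hz₀ : Measurable z₀) {s : Ω → ℕ → Ξ}
    (hs : ∀ i, Measurable fun ω => s ω i) (T : ℕ) :
    Measurable fun ω => ogdaAverage Y (fun t => field Gx Gy γ (z₀ ω).1 (s ω t)) η T (z₀ ω) := by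
  simp only [ogdaAverage_eq]
  exact (Finset.measurable_fun_sum (Finset.range T) fun t _ => (measurable_iterate_anchor (γ := γ)
    (η := η) hY hc hne hGx hGy hz₀ (t + 1)).1 fun i _ => hs i).const_smul (T : ℝ)⁻¹

/-! ### Step sizes, epoch lengths and the number of epochs. -/

section Parameters

variable {η₀ ε₀ σ ε ℓ μ μy M : ℝ}

lemma stepSize_pos (hη : 0 < η₀) (k : ℕ) : 0 < stepSize η₀ k :=
  mul_pos hη (Real.exp_pos _)

lemma stepSize_succ_le (hη : 0 < η₀) (k : ℕ) : stepSize η₀ (k + 1) ≤ η₀ := by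
  refine mul_le_of_le_one_right hη.le (Real.exp_le_one_iff.2 ?_)
  push_cast
  have : (0 : ℝ) ≤ k := by positivity
  linarith

lemma epochLength_pos (hη : 0 < η₀) (hμ : 0 < μ) (hμy : 0 < μy) (k : ℕ) :
    0 < epochLength η₀ μ μy k := by
  have : 0 < min (μ / 8) μy := lt_min (by positivity) hμy
  exact Nat.ceil_pos.2 (by positivity)

/-- The exponentials cancel, so `η_k T_k ≥ 384/α` in every epoch, with `α = min (μ/8) μy`; here `384
= 3 · 128` matches the factor 3 of the regret bound and the `α/128` required by the Lyapunov
inequality. -/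
lemma three_div_stepSize_mul_epochLength_le (hη : 0 < η₀) (hμ : 0 < μ) (hμy : 0 < μy) (k : ℕ) :
    3 / (stepSize η₀ k * epochLength η₀ μ μy k) ≤ min (μ / 8) μy / 128 := by
  have hα : 0 < min (μ / 8) μy := lt_min (by positivity) hμy
  have h1 := mul_le_mul_of_nonneg_left (Nat.le_ceil (384 / (η₀ * min (μ / 8) μy)
    * Real.exp (((k : ℝ) - 1) / 16))) (stepSize_pos hη k).le
  have e : stepSize η₀ k * (384 / (η₀ * min (μ / 8) μy) * Real.exp (((k : ℝ) - 1) / 16))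
      = 384 / min (μ / 8) μy := by
    rw [stepSize, neg_div, Real.exp_neg]
    field_simp
  rw [e] at h1
  have h2 : 0 < 384 / min (μ / 8) μy := by positivity
  calc 3 / (stepSize η₀ k * epochLength η₀ μ μy k) ≤ 3 / (384 / min (μ / 8) μy) :=
        div_le_div_of_nonneg_left (by norm_num) h2 h1
    _ = min (μ / 8) μy / 128 := by
        field_simp
        norm_num

/-- The regularized field has Lipschitz constant `ℓ + μ/4 ≤ (5/4) M`, and `(5/4)²/8 = 25/128`. -/
lemma stepSize_mul_sq_le (hη : 0 < η₀) (hℓ : 0 ≤ ℓ) (hμ : 0 < μ)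
    (hη' : η₀ ≤ 1 / (2 * √2 * max ℓ μ)) (k : ℕ) :
    (stepSize η₀ (k + 1) * (ℓ + μ / 4)) ^ 2 ≤ 25 / 128 := by
  have hM : 0 < max ℓ μ := lt_max_of_lt_right hμ
  have h2 : √2 ^ 2 = 2 := Real.sq_sqrt (by norm_num)
  have h1 : stepSize η₀ (k + 1) * (ℓ + μ / 4) ≤ 1 / (2 * √2 * max ℓ μ) * (5 / 4 * max ℓ μ) := by
    refine mul_le_mul ((stepSize_succ_le hη k).trans hη') ?_ (by positivity) (by positivity)
    linarith [le_max_left ℓ μ, le_max_right ℓ μ]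
  have h0 : 0 ≤ stepSize η₀ (k + 1) * (ℓ + μ / 4) :=
    mul_nonneg (stepSize_pos hη _).le (by positivity)
  calc (stepSize η₀ (k + 1) * (ℓ + μ / 4)) ^ 2
      ≤ (1 / (2 * √2 * max ℓ μ) * (5 / 4 * max ℓ μ)) ^ 2 := pow_le_pow_left₀ h0 h1 2
    _ = 25 / (64 * √2 ^ 2) := by
        field_simp
        norm_num
    _ = 25 / 128 := by
        rw [h2]
        norm_num

lemma le_exp_of_mul_log_le {a x : ℝ} (h : 16 * Real.log a ≤ x) : a ≤ Real.exp (x / 16) := by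
  -- For `a = 0` the logarithm takes the value 0. This occurs for `K = 0`, where the second term of
  -- the maximum is thereby dropped.
  rcases le_or_gt a 0 with ha | ha
  · exact ha.trans (Real.exp_pos _).le
  · rw [← Real.log_le_iff_le_exp ha]
    linarith

/-- After enough epochs, the contraction recursion is below the accuracy. -/
lemma EnoughEpochs.recursion_le {K : ℕ} (h : EnoughEpochs η₀ ε₀ σ ε K) (hε : 0 < ε) :
    532 * ε₀ * Real.exp (-(K : ℝ) / 16)
      + 7800 * η₀ * K * σ ^ 2 * Real.exp (-((K : ℝ) - 1) / 16) ≤ ε := by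
  have h1 := le_exp_of_mul_log_le ((le_max_left _ _).trans h)
  have h2 := le_exp_of_mul_log_le ((le_max_right _ _).trans h)
  rw [div_le_iff₀ hε] at h1 h2
  have e1 : Real.exp (-(K : ℝ) / 16) * Real.exp ((K : ℝ) / 16) = 1 := by
    rw [← Real.exp_add, neg_div, neg_add_cancel, Real.exp_zero]
  have e2 : Real.exp (-((K : ℝ) - 1) / 16) = Real.exp (-(K : ℝ) / 16) * Real.exp (1 / 16) := by
    rw [← Real.exp_add]
    congr 1
    ring
  have e3 : Real.exp (1 / 16) ≤ 16 / 15 := by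
    have h3 := Real.add_one_le_exp (-(1 / 16) : ℝ)
    have h4 : Real.exp (-(1 / 16) : ℝ) * Real.exp (1 / 16) = 1 := by
      rw [← Real.exp_add, neg_add_cancel, Real.exp_zero]
    nlinarith [Real.exp_pos (1 / 16 : ℝ)]
  set q := Real.exp (-(K : ℝ) / 16) with hq
  have hq0 : 0 < q := Real.exp_pos _
  have h3 : 1200 * ε₀ * q ≤ ε := by
    have := mul_le_mul_of_nonneg_left h1 hq0.le
    rw [← mul_assoc q (Real.exp _), e1] at this
    linarith
  have h4 : 15600 * η₀ * K * σ ^ 2 * q ≤ ε := by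
    have := mul_le_mul_of_nonneg_left h2 hq0.le
    rw [← mul_assoc q (Real.exp _), e1] at this
    linarith
  rw [e2]
  -- The two error terms are at most `532/1200` and `8/15` of `ε`, which sum to less than 1.
  have h5 : 7800 * η₀ * K * σ ^ 2 * (q * Real.exp (1 / 16)) ≤ ε / 2 * (16 / 15) := by
    rw [← mul_assoc]
    refine (mul_le_mul_of_nonneg_right (by linarith) (Real.exp_pos _).le).trans
      (mul_le_mul_of_nonneg_left e3 (by linarith))
  linarith

lemma log_le_of_le_two_pow_mul {a S : ℝ} (j : ℕ) (ha : 0 < a) (hS : 0 < S) (h : a ≤ 2 ^ j * S) :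
    Real.log a ≤ j * Real.log 2 + Real.log S := by
  rw [← Real.log_pow, ← Real.log_mul (by positivity) hS.ne']
  exact Real.log_le_log ha h

lemma noise_argument_le (hM : 0 < M) (hη : η₀ = 1 / (2 * √2 * M)) (hε : 0 < ε) (K : ℕ) :
    15600 * η₀ * K * σ ^ 2 / ε ≤ 2 ^ 13 * (K * (σ ^ 2 / (M * ε))) := by
  have h2 : 1 ≤ √2 := Real.one_le_sqrt.2 (by norm_num)
  have e : 15600 * η₀ * K * σ ^ 2 / ε = 7800 / √2 * (K * (σ ^ 2 / (M * ε))) := by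
    rw [hη]
    field_simp
    ring
  rw [e]
  refine mul_le_mul_of_nonneg_right ?_ (by positivity)
  rw [div_le_iff₀ (by positivity)]
  linarith

lemma exists_enoughEpochs (hM : 0 < M) (hη : η₀ = 1 / (2 * √2 * M)) (hε₀ : 0 < ε₀) (hσ : 0 < σ)
    (hε : 0 < ε) :
    ∃ K : ℕ, EnoughEpochs η₀ ε₀ σ ε K ∧
      (K : ℝ) ≤ 610 * Real.log (2 + ε₀ / ε + σ ^ 2 / (M * ε)) := by
  have hr : 0 < ε₀ / ε := by positivity
  have hv : 0 < σ ^ 2 / (M * ε) := by positivity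
  set S := 2 + ε₀ / ε + σ ^ 2 / (M * ε) with hS
  have hS0 : 0 < S := by positivity
  have hη0 : 0 < η₀ := hη ▸ by positivity
  have hl2 := Real.log_two_gt_d9
  have hl : Real.log 2 ≤ Real.log S := Real.log_le_log (by norm_num) (by linarith)
  set l := Real.log S with hl'
  -- The second condition contains `log K`, bounded by `K/32 + 5 log 2`. It becomes `K/2 + 16 · 19 l
  -- ≤ K`, whence `608 = 2 · 16 · 19`; rounding up costs less than `2l`.
  have hK : 608 * l ≤ (⌈608 * l⌉₊ : ℝ) := Nat.le_ceil _
  have hK' : (⌈608 * l⌉₊ : ℝ) < 608 * l + 1 := Nat.ceil_lt_add_one (by linarith)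
  set K := ⌈608 * l⌉₊ with hKdef
  have hK0 : (0 : ℝ) < K := by linarith
  refine ⟨K, max_le ?_ ?_, by linarith⟩
  · have := log_le_of_le_two_pow_mul (a := 1200 * ε₀ / ε) (S := S) 11 (by positivity) hS0
      (by rw [mul_div_assoc]; linarith)
    push_cast at this
    linarith
  · have h1 := noise_argument_le (σ := σ) hM hη hε K
    have h2 := log_le_of_le_two_pow_mul (a := 15600 * η₀ * K * σ ^ 2 / ε) (S := K * S) 13
      (by positivity) (by positivity)
      (h1.trans (by
        have : σ ^ 2 / (M * ε) ≤ S := by linarith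
        gcongr))
    have h3 : Real.log K ≤ K / 32 + 5 * Real.log 2 := by
      have h4 := Real.log_le_sub_one_of_pos (x := K / 32) (by positivity)
      have h5 := Real.log_pow 2 5
      norm_num at h5
      rw [Real.log_div hK0.ne' (by norm_num), h5] at h4
      linarith
    rw [Real.log_mul hK0.ne' hS0.ne'] at h2
    push_cast at h2
    linarith

/-- The total number of iterations is controlled by the length of the last epoch. -/
lemma sum_epochLength_le (hη : 0 < η₀) (hη' : η₀ * min (μ / 8) μy ≤ 384) (hμ : 0 < μ)
    (hμy : 0 < μy) (K : ℕ) :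
    ∑ k ∈ Finset.Icc 1 K, (epochLength η₀ μ μy k : ℝ)
      ≤ 17 * (768 / (η₀ * min (μ / 8) μy)) * Real.exp (((K : ℝ) - 1) / 16) := by
  have hα : 0 < min (μ / 8) μy := lt_min (by positivity) hμy
  set A := 384 / (η₀ * min (μ / 8) μy) with hA
  have hA1 : 1 ≤ A := by rwa [hA, one_le_div (by positivity)]
  have eA : 768 / (η₀ * min (μ / 8) μy) = 2 * A := by rw [hA]; ring
  rw [eA]
  induction K with
  | zero =>
    simp only [zero_lt_one, Finset.Icc_eq_empty_of_lt, Finset.sum_empty]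
    positivity
  | succ K ih =>
    rw [Finset.sum_Icc_succ_top (by omega)]
    have h1 : (epochLength η₀ μ μy (K + 1) : ℝ) ≤ 2 * A * Real.exp ((K : ℝ) / 16) := by
      have h2 : 1 ≤ A * Real.exp ((K : ℝ) / 16) :=
        one_le_mul_of_one_le_of_one_le hA1 (Real.one_le_exp (by positivity))
      have h3 := (Nat.ceil_lt_add_one (zero_le_one.trans h2)).le
      have e : epochLength η₀ μ μy (K + 1) = ⌈A * Real.exp ((K : ℝ) / 16)⌉₊ := by
        rw [epochLength, hA]
        push_cast
        rw [add_sub_cancel_right]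
      rw [e]
      linarith
    have h2 : Real.exp ((K : ℝ) / 16) = Real.exp (((K : ℝ) - 1) / 16) * Real.exp (1 / 16) := by
      rw [← Real.exp_add]
      congr 1
      ring
    have h3 : 17 / 16 ≤ Real.exp (1 / 16 : ℝ) := by
      linarith [Real.add_one_le_exp (1 / 16 : ℝ)]
    -- Geometric growth: an excess factor 17 on the sum leaves room for one more term, since
    -- `exp(1/16) ≥ 17/16`. The factor 2 in `2 * A` pays for rounding up.
    have h4 : 17 * Real.exp (((K : ℝ) - 1) / 16) ≤ 16 * Real.exp ((K : ℝ) / 16) := by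
      rw [h2]
      nlinarith [Real.exp_pos (((K : ℝ) - 1) / 16)]
    have h5 := mul_le_mul_of_nonneg_left h4 (by positivity : 0 ≤ 2 * A)
    push_cast
    rw [add_sub_cancel_right]
    linarith

/-- The number of epochs and the total number of iterations for the largest step size. -/
theorem exists_isLeast_enoughEpochs (hμ : 0 < μ) (hμy : 0 < μy) (hμM : μ ≤ M)
    (hη : η₀ = 1 / (2 * √2 * M)) (hε₀ : 0 < ε₀) (hσ : 0 < σ) (hε : 0 < ε) :
    ∃ K : ℕ, IsLeast {K : ℕ | EnoughEpochs η₀ ε₀ σ ε K} K ∧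
      (K : ℝ) ≤ 2 * 10 ^ 12 * Real.log (2 + ε₀ / ε + σ ^ 2 / (M * ε)) ∧
      (∑ k ∈ Finset.Icc 1 K, (epochLength η₀ μ μy k : ℝ))
        ≤ 2 * 10 ^ 12 * Real.log (2 + ε₀ / ε + σ ^ 2 / (M * ε))
          * (max (M * ε₀) (σ ^ 2) / (min μ μy * ε)) := by
  classical
  have hM : 0 < M := hμ.trans_le hμM
  obtain ⟨K₀, hK₀, hK₀le⟩ := exists_enoughEpochs hM hη hε₀ hσ hε
  have hex : ∃ K, EnoughEpochs η₀ ε₀ σ ε K := ⟨K₀, hK₀⟩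
  have hη0 : 0 < η₀ := hη ▸ by positivity
  have hmn : 0 < min μ μy := lt_min hμ hμy
  have hl : 1 / 2 ≤ Real.log (2 + ε₀ / ε + σ ^ 2 / (M * ε)) := by
    have h1 := Real.log_two_gt_d9
    have h2 : Real.log 2 ≤ Real.log (2 + ε₀ / ε + σ ^ 2 / (M * ε)) :=
      Real.log_le_log (by norm_num) (by
        have : 0 < ε₀ / ε := by positivity
        have : 0 < σ ^ 2 / (M * ε) := by positivity
        linarith)
    linarith
  set l := Real.log (2 + ε₀ / ε + σ ^ 2 / (M * ε)) with hl'
  have hK : IsLeast {K : ℕ | EnoughEpochs η₀ ε₀ σ ε K} (Nat.find hex) :=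
    ⟨Nat.find_spec hex, fun _ hb => Nat.find_min' hex hb⟩
  have hKle : (Nat.find hex : ℝ) ≤ 610 * l :=
    (Nat.cast_le.2 (Nat.find_min' hex hK₀)).trans hK₀le
  have hKmin := fun j (hj : j < Nat.find hex) => Nat.find_min hex hj
  set K := Nat.find hex with hKdef
  refine ⟨K, hK, by linarith, ?_⟩
  rcases Nat.eq_zero_or_pos K with h0 | hpos
  · rw [h0]
    simp only [zero_lt_one, Finset.Icc_eq_empty_of_lt, Finset.sum_empty]
    positivity
  obtain ⟨j, hj⟩ : ∃ j, K = j + 1 := ⟨K - 1, by omega⟩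
  set D := max (M * ε₀) (σ ^ 2) / (M * ε) with hD
  have hD1 : ε₀ / ε ≤ D := by
    have : ε₀ / ε = M * ε₀ / (M * ε) := by field_simp
    rw [this, hD]
    exact div_le_div_of_nonneg_right (le_max_left _ _) (by positivity)
  have hD2 : σ ^ 2 / (M * ε) ≤ D := div_le_div_of_nonneg_right (le_max_right _ _) (by positivity)
  have hD0 : 0 ≤ D := (by positivity : 0 ≤ ε₀ / ε).trans hD1
  -- As `j = K - 1` epochs are not enough, one of the two logarithmic conditions fails at `j`, which
  -- bounds `exp(j/16)` from above.
  have hexp : Real.exp ((j : ℝ) / 16) ≤ 5 * 10 ^ 6 * (l * D) := by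
    have hnot := hKmin j (by omega)
    rw [EnoughEpochs, not_le, lt_max_iff] at hnot
    rcases hnot with h | h
    · have h1 : Real.exp ((j : ℝ) / 16) < 1200 * ε₀ / ε :=
        (Real.lt_log_iff_exp_lt (by positivity)).1 (by linarith)
      rw [mul_div_assoc] at h1
      nlinarith
    · have hj0 : 0 < j := by
        rcases Nat.eq_zero_or_pos j with h0 | h0
        -- For `j = 0` the noise condition is the logarithm of 0, which is 0, so it cannot fail.
        · simp [h0] at h
        · exact h0
      have h1 : Real.exp ((j : ℝ) / 16) < 15600 * η₀ * j * σ ^ 2 / ε :=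
        (Real.lt_log_iff_exp_lt (by positivity)).1 (by linarith)
      have h2 := noise_argument_le (σ := σ) hM hη hε j
      have h3 : (j : ℝ) ≤ 610 * l := by
        rw [hj] at hKle
        push_cast at hKle
        linarith
      have h4 : (j : ℝ) * (σ ^ 2 / (M * ε)) ≤ 610 * l * D :=
        mul_le_mul h3 hD2 (by positivity) (by positivity)
      have : 0 ≤ l * D := by positivity
      linarith
  have hα : min μ μy / 8 ≤ min (μ / 8) μy :=
    le_min (by linarith [min_le_left μ μy]) (by linarith [min_le_right μ μy])
  have h2 : √2 ≤ 3 / 2 := Real.sqrt_le_iff.2 ⟨by norm_num, by norm_num⟩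
  have h2' : 1 ≤ √2 := Real.one_le_sqrt.2 (by norm_num)
  have hη' : η₀ * min (μ / 8) μy ≤ 384 := by
    have h3 : η₀ * min (μ / 8) μy ≤ 1 / (2 * √2 * M) * M := by
      rw [← hη]
      exact mul_le_mul_of_nonneg_left (by linarith [min_le_left (μ / 8) μy]) hη0.le
    have h4 : 1 / (2 * √2 * M) * M = 1 / (2 * √2) := by field_simp
    have h5 : 1 / (2 * √2) ≤ 1 := by
      rw [div_le_one (by positivity)]
      linarith
    linarith
  have hA : 768 / (η₀ * min (μ / 8) μy) ≤ 18432 * M / min μ μy := by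
    have e : 18432 * M / min μ μy = 768 / (1 / (3 * M) * (min μ μy / 8)) := by
      field_simp
      norm_num
    rw [e]
    refine div_le_div_of_nonneg_left (by norm_num) (by positivity) ?_
    refine mul_le_mul ?_ hα (by positivity) hη0.le
    rw [hη]
    refine div_le_div_of_nonneg_left (by norm_num) (by positivity) ?_
    exact mul_le_mul_of_nonneg_right (by linarith) hM.le
  have hsum := sum_epochLength_le hη0 hη' hμ hμy K
  have eK : ((K : ℝ) - 1) / 16 = (j : ℝ) / 16 := by
    rw [hj]
    push_cast
    ring
  rw [eK] at hsum
  have eD : max (M * ε₀) (σ ^ 2) / (min μ μy * ε) = M / min μ μy * D := by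
    rw [hD]
    field_simp
  calc (∑ k ∈ Finset.Icc 1 K, (epochLength η₀ μ μy k : ℝ))
      ≤ 17 * (768 / (η₀ * min (μ / 8) μy)) * Real.exp ((j : ℝ) / 16) := hsum
    _ ≤ 17 * (18432 * M / min μ μy) * (5 * 10 ^ 6 * (l * D)) :=
        mul_le_mul (by linarith) hexp (Real.exp_pos _).le (by positivity)
    _ = 17 * 18432 * 5 * 10 ^ 6 * (l * (M / min μ μy * D)) := by ring
    _ ≤ 2 * 10 ^ 12 * (l * (M / min μ μy * D)) :=
        mul_le_mul_of_nonneg_right (by norm_num) (by positivity)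
    _ = 2 * 10 ^ 12 * l * (max (M * ε₀) (σ ^ 2) / (min μ μy * ε)) := by
        rw [eD]
        ring

end Parameters

/-! ### The proximal epoch method: filtration, contraction in expectation and unrolling. -/

section Convergence

variable {n m : ℕ} {Ξ Ω : Type*} {Y : Set (Vec m)} {f : Vec n → Vec m → ℝ}
  {gx : Vec n → Vec m → Vec n} {gy : Vec n → Vec m → Vec m} {Gx : Vec n → Vec m → Ξ → Vec n}
  {Gy : Vec n → Vec m → Ξ → Vec m} {ℓ μ μy L ρ σ γ ε₀ η₀ : ℝ}

/-- The infimum over `x'` is uncountable; continuity in `x'` reduces it to a countable dense set,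
where each term is measurable by continuity of `f x'` on `Y`. -/
lemma IsSmoothNCSC.measurable_lyapunov {_ : MeasurableSpace Ω}
    (h : IsSmoothNCSC Y f gx gy ℓ μy L) (hμy : 0 < μy) {z : Ω → Vec n × Vec m}
    (hz : Measurable z) (hmem : ∀ ω, (z ω).2 ∈ Y) (xs : Vec n) :
    Measurable fun ω => lyapunov Y f γ xs (z ω) := by
  have hP : Measurable fun ω => primal Y f (z ω).1 :=
    h.primal_smooth.1.continuous.measurable.comp hz.fst
  have hval : ∀ x', Measurable fun ω => regularized f γ (z ω).1 x' (z ω).2 := fun x' => by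
    have hc : ContinuousOn (f x') Y := fun y hy =>
      (h.hasGradientY x' y hy).hasFDerivWithinAt.continuousWithinAt
    have h1 : Measurable fun ω => f x' (z ω).2 :=
      hc.domRestrict.measurable.comp (hz.snd.subtype_mk (h := hmem))
    exact h1.add (((hz.fst.const_sub x').norm.pow_const 2).const_mul (γ / 2))
  have hinf : Measurable fun ω => sInf (Set.range fun x' => regularized f γ (z ω).1 x' (z ω).2) := by
    have e : (fun ω => sInf (Set.range fun x' => regularized f γ (z ω).1 x' (z ω).2))
        = fun ω => ⨅ x' : Set.range (TopologicalSpace.denseSeq (Vec n)),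
          regularized f γ (z ω).1 x' (z ω).2 := by
      funext ω
      have hc : Continuous fun x' => regularized f γ (z ω).1 x' (z ω).2 := by
        have : Continuous fun u => f u (z ω).2 := continuous_iff_continuousAt.2 fun u =>
          (h.hasGradientX u _ (hmem ω)).hasFDerivAt.continuousAt
        unfold regularized
        fun_prop
      exact (Dense.ciInf' (TopologicalSpace.denseRange_denseSeq (Vec n)) hc).symm
    rw [e]
    have : Countable (Set.range (TopologicalSpace.denseSeq (Vec n))) :=
      (Set.countable_range _).to_subtype
    exact Measurable.iInf fun x' => hval x'
  have e : (fun ω => lyapunov Y f γ xs (z ω)) = fun ω =>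
      475 * (primal Y f (z ω).1 - primal Y f xs) + 57 * (primal Y f (z ω).1
        - sInf (Set.range fun x' => regularized f γ (z ω).1 x' (z ω).2)) := by
    funext ω
    rw [lyapunov, gap, h.primal_regularized hμy ⟨_, hmem ω⟩, sub_self, norm_zero]
    ring
  rw [e]
  exact ((hP.sub_const _).const_mul 475).add ((hP.sub hinf).const_mul 57)

/-- At the starting point the Lyapunov function is controlled by the duality gap of the original
objective. -/
lemma IsSmoothNCSC.lyapunov_start_le (h : IsSmoothNCSC Y f gx gy ℓ μy L) (hμy : 0 < μy)
    (hγ : 0 ≤ γ) {z : Vec n × Vec m} (hgap : InitialGapLE Y f z ε₀) (xs : Vec n) :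
    lyapunov Y f γ xs z ≤ 532 * ε₀ := by
  obtain ⟨hz, hb, hg⟩ := hgap
  have h1 : gap Y (regularized f γ z.1) z ≤ gap Y f z := by
    rw [gap, gap, h.primal_regularized hμy ⟨_, hz⟩, sub_self, norm_zero]
    have : sInf (Set.range fun x' => f x' z.2)
        ≤ sInf (Set.range fun x' => regularized f γ z.1 x' z.2) := by
      refine le_csInf (Set.range_nonempty _) ?_
      rintro _ ⟨x', rfl⟩
      have h2 : 0 ≤ γ / 2 * ‖x' - z.1‖ ^ 2 := by positivity
      have h3 : sInf (Set.range fun x' => f x' z.2) ≤ f x' z.2 := csInf_le hb ⟨x', rfl⟩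
      simp only [regularized]
      linarith
    linarith
  have h2 : primal Y f z.1 - primal Y f xs ≤ gap Y f z := by
    have h3 : sInf (Set.range fun x' => f x' z.2) ≤ f xs z.2 := csInf_le hb ⟨xs, rfl⟩
    rw [gap]
    linarith [h.le_primal hμy xs hz]
  -- Regularizing at the point itself only raises the infimum, and `f(x_*, y₀) ≤ P(x_*)`; so both
  -- parts are at most the initial gap, and `475 + 57 = 532`.
  rw [lyapunov]
  linarith

variable (Y Gx Gy μ μy η₀) in
/-- The iterates of the proximal epoch method with its epoch-dependent step sizes and lengths. -/
noncomputable def epochIterate (z₀ : Vec n × Vec m) (ξ : ℕ → ℕ → Ω → Ξ) (k : ℕ) (ω : Ω) :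
    Vec n × Vec m :=
  pes Y Gx Gy (μ / 4) (stepSize η₀) (epochLength η₀ μ μy) z₀ (fun j t => ξ j t ω) k

lemma epochIterate_succ (z₀ : Vec n × Vec m) (ξ : ℕ → ℕ → Ω → Ξ) (k : ℕ) (ω : Ω) :
    epochIterate Y Gx Gy μ μy η₀ z₀ ξ (k + 1) ω
      = ogdaAverage Y (fun t => field Gx Gy (μ / 4) (epochIterate Y Gx Gy μ μy η₀ z₀ ξ k ω).1
          (ξ (k + 1) t ω)) (stepSize η₀ (k + 1)) (epochLength η₀ μ μy (k + 1))
          (epochIterate Y Gx Gy μ μy η₀ z₀ ξ k ω) := rfl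

variable [MeasurableSpace Ξ]

lemma measurable_epochIterate {_ : MeasurableSpace Ω} (h : IsSmoothNCSC Y f gx gy ℓ μy L)
    (hGx : Measurable fun p : (Vec n × Vec m) × Ξ => Gx p.1.1 p.1.2 p.2)
    (hGy : Measurable fun p : (Vec n × Vec m) × Ξ => Gy p.1.1 p.1.2 p.2) {z₀ : Vec n × Vec m}
    (hz₀ : z₀.2 ∈ Y) {ξ : ℕ → ℕ → Ω → Ξ} (k : ℕ) (hξ : ∀ j ≤ k, ∀ t, Measurable (ξ j t)) :
    Measurable (epochIterate Y Gx Gy μ μy η₀ z₀ ξ k) := by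
  induction k with
  | zero => exact measurable_const
  | succ k ih =>
    exact measurable_ogdaAverage (s := fun ω t => ξ (k + 1) t ω) h.isClosed h.convex ⟨_, hz₀⟩
      hGx hGy (ih fun j hj => hξ j (by omega)) (hξ (k + 1) le_rfl) _

/-- The indices of the samples drawn before sample `t` of epoch `k`. -/
def pastIndices (k t : ℕ) : Set (ℕ × ℕ) := {i | i.1 < k ∨ i.1 = k ∧ i.2 < t}

/-- The information available before sample `t` of epoch `k`. -/
abbrev past (ξ : ℕ → ℕ → Ω → Ξ) (k t : ℕ) : MeasurableSpace Ω :=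
  ⨆ i ∈ pastIndices k t, MeasurableSpace.comap (ξ i.1 i.2) inferInstance

lemma measurable_past {ξ : ℕ → ℕ → Ω → Ξ} {k t : ℕ} {i : ℕ × ℕ} (hi : i ∈ pastIndices k t) :
    Measurable[past ξ k t] (ξ i.1 i.2) :=
  measurable_iff_comap_le.2 (le_iSup₂_of_le i hi le_rfl)

variable [MeasurableSpace Ω] {Pr : Measure Ω}

lemma indep_past {ξ : ℕ → ℕ → Ω → Ξ} (hξ : ∀ k t, Measurable (ξ k t))
    (hind : iIndepFun (fun i : ℕ × ℕ => ξ i.1 i.2) Pr) (k t : ℕ) :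
    Indep (past ξ k t) (MeasurableSpace.comap (ξ k t) inferInstance) Pr := by
  have h := indep_iSup_of_disjoint (fun i : ℕ × ℕ => (hξ i.1 i.2).comap_le) hind
    (S := pastIndices k t) (T := {(k, t)}) (by
      rw [Set.disjoint_singleton_right]
      simp [pastIndices])
  simp only [Set.mem_singleton_iff, iSup_iSup_eq_left] at h
  exact h

variable [IsProbabilityMeasure Pr]

/-- The epochs of the method fit the analysis of the inner solver. -/
lemma epochSetup (h : IsSmoothNCSC Y f gx gy ℓ μy L) (hℓ : 0 ≤ ℓ) (hμ : 0 < μ)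
    (hGx : Measurable fun p : (Vec n × Vec m) × Ξ => Gx p.1.1 p.1.2 p.2)
    (hGy : Measurable fun p : (Vec n × Vec m) × Ξ => Gy p.1.1 p.1.2 p.2) {z₀ : Vec n × Vec m}
    (hz₀ : z₀.2 ∈ Y) {ξ : ℕ → ℕ → Ω → Ξ} (hξ : ∀ k t, Measurable (ξ k t))
    (hind : iIndepFun (fun i : ℕ × ℕ => ξ i.1 i.2) Pr)
    (hor : ∀ k t, IsStochasticGradient Y gx gy Gx Gy σ (Pr.map (ξ k t)))
    (hmem : ∀ k ω, (epochIterate Y Gx Gy μ μy η₀ z₀ ξ k ω).2 ∈ Y) (k : ℕ) :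
    EpochSetup Y f gx gy Gx Gy ℓ μy L σ Pr (epochIterate Y Gx Gy μ μy η₀ z₀ ξ k)
      (fun ω t => ξ (k + 1) t ω) (past ξ (k + 1)) := by
  have hmono : Monotone (past ξ (k + 1)) := fun t t' htt' =>
    biSup_mono fun i hi => hi.imp_right fun hi' => ⟨hi'.1, hi'.2.trans_le htt'⟩
  induction k with
  | zero =>
    exact {
      smooth := h
      nonneg := hℓ
      measurableX := hGx
      measurableY := hGy
      le := fun t => iSup₂_le fun i _ => (hξ i.1 i.2).comap_le
      mono := hmono
      measurable_start := measurable_const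
      memLp_start := memLp_const (WithLp.toLp 2 z₀ : Pair n m)
      mem_start := hmem 0
      measurable_sample := fun t => measurable_past (i := (1, t)) (Or.inr ⟨rfl, Nat.lt_succ_self t⟩)
      indep := indep_past hξ hind 1
      oracle := hor 1 }
  | succ k ih =>
    have S := ih fun t t' htt' =>
      biSup_mono fun i hi => hi.imp_right fun hi' => ⟨hi'.1, hi'.2.trans_le htt'⟩
    exact {
      smooth := h
      nonneg := hℓ
      measurableX := hGx
      measurableY := hGy
      le := fun t => iSup₂_le fun i _ => (hξ i.1 i.2).comap_le
      mono := hmono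
      measurable_start := measurable_epochIterate h hGx hGy hz₀ (k + 1) fun j hj t =>
        measurable_past (i := (j, t)) (Or.inl (Nat.lt_succ_of_le hj))
      memLp_start := S.memLp_ogdaAverage (by positivity) _
      mem_start := hmem (k + 1)
      measurable_sample := fun t =>
        measurable_past (i := (k + 1 + 1, t)) (Or.inr ⟨rfl, Nat.lt_succ_self t⟩)
      indep := indep_past hξ hind (k + 1 + 1)
      oracle := hor (k + 1 + 1) }

/-- One epoch contracts the Lyapunov function in expectation, up to the noise. -/
theorem lyapunov_epochIterate_spec (h : IsSmoothNCSC Y f gx gy ℓ μy L) (hℓ : 0 ≤ ℓ) (hμ : 0 < μ)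
    (hμy : 0 < μy) (hw : WeaklyConvexX Y f gx ρ) (hρ : ρ ≤ μ / 8) {xs : Vec n}
    (hxs : ∀ x, primal Y f xs ≤ primal Y f x) (hPL : PLCondition (primal Y f) μ)
    (hGx : Measurable fun p : (Vec n × Vec m) × Ξ => Gx p.1.1 p.1.2 p.2)
    (hGy : Measurable fun p : (Vec n × Vec m) × Ξ => Gy p.1.1 p.1.2 p.2) {z₀ : Vec n × Vec m}
    (hz₀ : z₀.2 ∈ Y) {ξ : ℕ → ℕ → Ω → Ξ} (hξ : ∀ k t, Measurable (ξ k t))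
    (hind : iIndepFun (fun i : ℕ × ℕ => ξ i.1 i.2) Pr)
    (hor : ∀ k t, IsStochasticGradient Y gx gy Gx Gy σ (Pr.map (ξ k t)))
    (hη : 0 < η₀) (hη' : η₀ ≤ 1 / (2 * √2 * max ℓ μ)) (k : ℕ) :
    Integrable (fun ω => lyapunov Y f (μ / 4) xs (epochIterate Y Gx Gy μ μy η₀ z₀ ξ k ω)) Pr ∧
      ∫ ω, lyapunov Y f (μ / 4) xs (epochIterate Y Gx Gy μ μy η₀ z₀ ξ (k + 1) ω) ∂Pr
        ≤ Real.exp (-1 / 16) * ∫ ω, lyapunov Y f (μ / 4) xs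
            (epochIterate Y Gx Gy μ μy η₀ z₀ ξ k ω) ∂Pr
          + 7800 * stepSize η₀ (k + 1) * σ ^ 2 := by
  have hργ : ρ < μ / 4 := by linarith
  have hstep : ∀ k ω, (epochIterate Y Gx Gy μ μy η₀ z₀ ξ k ω).2 ∈ Y →
      (epochIterate Y Gx Gy μ μy η₀ z₀ ξ (k + 1) ω).2 ∈ Y ∧
      lyapunov Y f (μ / 4) xs (epochIterate Y Gx Gy μ μy η₀ z₀ ξ (k + 1) ω)
        ≤ Real.exp (-1 / 16) * lyapunov Y f (μ / 4) xs (epochIterate Y Gx Gy μ μy η₀ z₀ ξ k ω)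
          + 589 * 64 / 63 * epochNoise Y gx gy Gx Gy (μ / 4) (stepSize η₀ (k + 1))
            (epochLength η₀ μ μy (k + 1)) (epochIterate Y Gx Gy μ μy η₀ z₀ ξ k ω)
            (fun t => ξ (k + 1) t ω) := fun k ω hω => by
    obtain ⟨h1, h2⟩ := h.ogdaAverage_spec hμy.le hw hργ.le (by positivity) hℓ
      (stepSize_pos hη (k + 1)) (stepSize_mul_sq_le hη hℓ hμ hη' k)
      (epochLength_pos hη hμ hμy (k + 1)) hω (fun t => ξ (k + 1) t ω)
      (epochIterate_succ z₀ ξ k ω)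
    exact ⟨h1, h.lyapunov_le hμy hw hμ hρ hxs hPL hω h1
      (three_div_stepSize_mul_epochLength_le hη hμ hμy (k + 1)) h2⟩
  have hmem : ∀ k ω, (epochIterate Y Gx Gy μ μy η₀ z₀ ξ k ω).2 ∈ Y := fun k ω => by
    induction k with
    | zero => exact hz₀
    | succ k ih => exact (hstep k ω ih).1
  have hnoise := fun k => (epochSetup h hℓ hμ hGx hGy hz₀ hξ hind hor hmem k).epochNoise_spec
    (γ := μ / 4) (by positivity) (stepSize_pos hη (k + 1)) (epochLength_pos hη hμ hμy (k + 1))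
  have hint : ∀ k, Integrable (fun ω => lyapunov Y f (μ / 4) xs
      (epochIterate Y Gx Gy μ μy η₀ z₀ ξ k ω)) Pr := fun k => by
    induction k with
    | zero => exact integrable_const (lyapunov Y f (μ / 4) xs z₀)
    | succ k ih =>
      have hm := h.measurable_lyapunov (γ := μ / 4) hμy
        (measurable_epochIterate h hGx hGy hz₀ (k + 1) fun j _ t => hξ j t) (hmem (k + 1)) xs
      -- Domination: the Lyapunov function lies between 0 and the pathwise bound, which is
      -- integrable by induction.
      refine ((ih.const_mul (Real.exp (-1 / 16))).add
        ((hnoise k).1.const_mul (589 * 64 / 63))).mono' hm.aestronglyMeasurable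
        (Filter.Eventually.of_forall fun ω => ?_)
      rw [Real.norm_of_nonneg (h.lyapunov_nonneg hμy hw hργ hxs (hmem (k + 1) ω))]
      exact (hstep k ω (hmem k ω)).2
  refine ⟨hint k, ?_⟩
  have h1 := integral_mono (hint (k + 1)) ((hint k).const_mul (Real.exp (-1 / 16)) |>.add
    ((hnoise k).1.const_mul (589 * 64 / 63))) fun ω => (hstep k ω (hmem k ω)).2
  simp only [Pi.add_apply] at h1
  rw [integral_add ((hint k).const_mul _) ((hnoise k).1.const_mul _), integral_const_mul,
    integral_const_mul] at h1
  -- The constant is `589 · (64/63) · (64/5) < 7800`.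
  have h2 := (hnoise k).2
  have h3 : 0 ≤ stepSize η₀ (k + 1) * σ ^ 2 := mul_nonneg (stepSize_pos hη _).le (sq_nonneg σ)
  linarith

/-- Unrolling of the contraction, with the geometrically decaying step sizes. -/
lemma le_of_contraction {D : ℕ → ℝ} (hD : ∀ k, D (k + 1) ≤ Real.exp (-1 / 16) * D k
      + 7800 * stepSize η₀ (k + 1) * σ ^ 2) (K : ℕ) :
    D K ≤ D 0 * Real.exp (-(K : ℝ) / 16)
      + 7800 * η₀ * K * σ ^ 2 * Real.exp (-((K : ℝ) - 1) / 16) := by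
  induction K with
  | zero => simp
  | succ K ih =>
    have h1 := mul_le_mul_of_nonneg_left ih (Real.exp_pos (-1 / 16)).le
    have e1 : Real.exp (-((K + 1 : ℕ) : ℝ) / 16)
        = Real.exp (-1 / 16) * Real.exp (-(K : ℝ) / 16) := by
      rw [← Real.exp_add]
      congr 1
      push_cast
      ring
    have e2 : Real.exp (-(((K + 1 : ℕ) : ℝ) - 1) / 16)
        = Real.exp (-1 / 16) * Real.exp (-((K : ℝ) - 1) / 16) := by
      rw [← Real.exp_add]
      congr 1
      push_cast
      ring
    have h2 := hD K
    -- The new noise carries the same exponential as the contracted old noise, so the factor just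
    -- grows from `K` to `K + 1`.
    rw [stepSize, e2] at h2
    rw [e1, e2]
    push_cast
    linarith

end Convergence

end PES

theorem theorem2 :
    ∃ C : ℝ, 0 < C ∧
    ∀ (n m : ℕ) (Y : Set (PES.Vec m)) (f : PES.Vec n → PES.Vec m → ℝ)
      (gx : PES.Vec n → PES.Vec m → PES.Vec n) (gy : PES.Vec n → PES.Vec m → PES.Vec m)
      (ℓ μ μy L ρ σ ε₀ : ℝ)
      (xs x₀ : PES.Vec n) (y₀ : PES.Vec m)
      (Ξ Ω : Type*) (_ : MeasurableSpace Ξ) (_ : MeasurableSpace Ω)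
      (Pr : Measure Ω) (_ : IsProbabilityMeasure Pr)
      (Gx : PES.Vec n → PES.Vec m → Ξ → PES.Vec n) (Gy : PES.Vec n → PES.Vec m → Ξ → PES.Vec m)
      (ξ : ℕ → ℕ → Ω → Ξ),
      0 < μ → 0 < μy → 0 < σ → 0 < ε₀ →
      -- the objective
      PES.IsSmoothNCSC Y f gx gy ℓ μy L →
      PES.InitialGapLE Y f (x₀, y₀) ε₀ →
      (∀ x, PES.primal Y f xs ≤ PES.primal Y f x) →
      PES.PLCondition (PES.primal Y f) μ →
      0 < ρ → ρ ≤ ℓ → ρ ≤ μ / 8 →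
      PES.WeaklyConvexX Y f gx ρ →
      -- independent samples and the stochastic gradients
      (Measurable fun p : (PES.Vec n × PES.Vec m) × Ξ => Gx p.1.1 p.1.2 p.2) →
      (Measurable fun p : (PES.Vec n × PES.Vec m) × Ξ => Gy p.1.1 p.1.2 p.2) →
      (∀ k t, Measurable (ξ k t)) →
      iIndepFun (fun i : ℕ × ℕ => ξ i.1 i.2) Pr →
      (∀ k t, PES.IsStochasticGradient Y gx gy Gx Gy σ (Pr.map (ξ k t))) →
      -- convergence, for every admissible initial step size
      (∀ η₀ : ℝ, 0 < η₀ → η₀ ≤ 1 / (2 * √2 * max ℓ μ) →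
        ∀ Δ : ℕ → Ω → ℝ,
        -- `Δ k` is the Lyapunov function at the start of epoch `k`, at `(x_{k-1}, y_{k-1})`
        (∀ k ω, Δ k ω = PES.lyapunov Y f (μ / 4) xs
          (PES.pes Y Gx Gy (μ / 4) (PES.stepSize η₀) (PES.epochLength η₀ μ μy) (x₀, y₀)
            (fun j t => ξ j t ω) (k - 1))) →
        (∀ k, 1 ≤ k → Integrable (Δ k) Pr) ∧
        (∀ k, 1 ≤ k → ∫ ω, Δ (k + 1) ω ∂Pr
          ≤ Real.exp (-1 / 16) * ∫ ω, Δ k ω ∂Pr + 7800 * PES.stepSize η₀ k * σ ^ 2) ∧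
        (∀ ε : ℝ, 0 < ε → ∀ K : ℕ, PES.EnoughEpochs η₀ ε₀ σ ε K →
          ∫ ω, Δ (K + 1) ω ∂Pr ≤ ε)) ∧
      -- number of epochs and total number of iterations, for the largest initial step size
      (∀ η₀ : ℝ, η₀ = 1 / (2 * √2 * max ℓ μ) → ∀ ε : ℝ, 0 < ε →
        ∃ K : ℕ, IsLeast {K : ℕ | PES.EnoughEpochs η₀ ε₀ σ ε K} K ∧
          (K : ℝ) ≤ C * Real.log (2 + ε₀ / ε + σ ^ 2 / (max ℓ μ * ε)) ∧
          (∑ k ∈ Finset.Icc 1 K, (PES.epochLength η₀ μ μy k : ℝ))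
            ≤ C * Real.log (2 + ε₀ / ε + σ ^ 2 / (max ℓ μ * ε))
              * (max (max ℓ μ * ε₀) (σ ^ 2) / (min μ μy * ε))) := by
  refine ⟨2 * 10 ^ 12, by norm_num, ?_⟩
  intro n m Y f gx gy ℓ μ μy L ρ σ ε₀ xs x₀ y₀ Ξ Ω _ _ Pr _ Gx Gy ξ hμ hμy hσ hε₀ h hgap hxs hPL
    hρ0 hρℓ hρ hw hGx hGy hξ hind hor
  have hℓ : 0 ≤ ℓ := hρ0.le.trans hρℓ
  refine ⟨fun η₀ hη hη' Δ hΔ => ?_, fun η₀ hη ε hε =>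
    PES.exists_isLeast_enoughEpochs hμ hμy (le_max_right ℓ μ) hη hε₀ hσ hε⟩
  have hspec := PES.lyapunov_epochIterate_spec h hℓ hμ hμy hw hρ hxs hPL hGx hGy
    (z₀ := (x₀, y₀)) hgap.1 hξ hind hor hη hη'
  -- Index shift: `Δ (k + 1)` is evaluated at the output of epoch `k`; in particular `Δ 1` is the
  -- deterministic value at the starting point.
  have hΔ' : ∀ k, Δ (k + 1) = fun ω => PES.lyapunov Y f (μ / 4) xs
      (PES.epochIterate Y Gx Gy μ μy η₀ (x₀, y₀) ξ k ω) := fun k => funext (hΔ (k + 1))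
  simp only [← hΔ'] at hspec
  refine ⟨fun k hk => ?_, fun k hk => ?_, fun ε hε K hK => ?_⟩
  · obtain ⟨j, rfl⟩ := Nat.exists_eq_add_of_le' hk
    exact (hspec j).1
  · obtain ⟨j, rfl⟩ := Nat.exists_eq_add_of_le' hk
    exact (hspec j).2
  · have h1 := PES.le_of_contraction (D := fun k => ∫ ω, Δ (k + 1) ω ∂Pr) (fun k => (hspec k).2) K
    have h2 : ∫ ω, Δ (0 + 1) ω ∂Pr ≤ 532 * ε₀ := by
      have h3 := h.lyapunov_start_le hμy (by positivity : 0 ≤ μ / 4) hgap xs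
      rw [hΔ' 0]
      change ∫ _, PES.lyapunov Y f (μ / 4) xs (x₀, y₀) ∂Pr ≤ _
      rwa [integral_const, probReal_univ, one_smul]
    have h3 := mul_le_mul_of_nonneg_right h2 (Real.exp_pos (-(K : ℝ) / 16)).le
    exact h1.trans ((add_le_add_left h3 _).trans (hK.recursion_le hε))
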